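/- Let $n\ge 3$ and let $w=(w_1,\dots,w_n)\in\mathbb{Q}^n$ with $0<w_i\le 1$. Call $i$ heavy in $w$ if $w_i+w_j>1$ for all $j\ne i$, and assume that $w$ has at least two heavy entries. Fix one heavy entry $h$, and let the reduced weight graph $G(w)$ be the graph on $[n]\setminus\{h\}$ in which distinct $i,j$ are adjacent if and only if $w_i+w_j>1$. For a matroid $M$ on a finite set $E$, the Bergman fan $B(M)\subseteq\mathbb{R}^E$ is the set of all $x$ such that every $e\in E$ lies in a basis of $M$ of minimal $x$-weight; $B'(M)=B(M)/L$, where $L$ is spanned by $(1,\dots,1)$, and $B'(G)=B'(M_G)$ for the cycle matroid $M_G$ of a graph $G$. For a flat $F$ put $v_F=-\sum_{i\in F}e_i$. The set $\mathcal{G}_{G}$ of $1$-connected flats consists of the nonempty flats $F$ of $M_G$ for which the subgraph of $G$ formed by the edges in $F$ is connected. A subset $S\subseteq\mathcal{G}_G$ is nested if the join of any at least two pairwise incomparable elements of $S$ is not in $\mathcal{G}_G$. The cones of the nested set subdivision of $B'(G)$ with respect to $\mathcal{G}_G$ are the cones in $\mathbb{R}^E/L$ spanned by $\{v_F : F\in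 S\}$ for $S$ nested. An $n$-marked rational tropical curve is a finite metric tree with $n$ marked ends attached to its vertices, all vertices being at least $3$-valent; its combinatorial type is the underlying tree with the attached ends, up to isomorphism. Let $M^{\mathrm{trop}}_{0,n}\subseteq\mathbb{R}^{\binom n2}/\Phi(\mathbb{R}^n)$, $\Phi(x)=(x_i+x_j)_{i<j}$, be the set of vectors $(\mathrm{dist}(i,j))_{i<j}$ of such curves. For $I\subseteq[n]$ let $v_I$ be the class of the vector whose entry at $\{i,j\}$ is $1$ if exactly one of $i,j$ is in $I$, and $0$ otherwise. The cone $\sigma_T$ of a combinatorial type $T$ is spanned by the $v_I$ for the splits $I\sqcup I^c=[n]$ induced by the bounded edges of $T$; it is top-dimensional if $T$ has $n-3$ bounded edges. Let $\mathrm{pr}_w$ be the composition of the linear isomorphism $\mathbb{R}^{\binom n2}/\Phi(\mathbb{R}^n)\to\mathbb{R}^{E(K_{n-1})}/L$, $d\mapsto\big(\tfrac12(d_{ij}-d_{hi}-d_{hj})\big)_{ij}$, where $K_{n-1}$ is the complete graph on $[n]\setminus\{h\}$, with the projection $\mathbb{R}^{E(K_{n-1})}/L\to\mathbb{R}^{E(G(w))}/L$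 that forgets the coordinates of the edges not in $G(w)$. (For $h\notin I$ the isomorphism sends $v_I$ to $v_F$, where $F$ is the flat of all edges between elements of $I$.) Say that a combinatorial type $T$ survives if $\sigma_T$ is a face of a top-dimensional cone $\sigma_{T'}$ on which $\mathrm{pr}_w$ is injective. Theorem. $\mathrm{pr}_w(M^{\mathrm{trop}}_{0,n})=B'(G(w))$. Moreover, for every combinatorial type $T$ the image $\mathrm{pr}_w(\sigma_T)$ is a cone of the nested set subdivision of $B'(G(w))$ with respect to $\mathcal{G}_{G(w)}$, and $T\mapsto\mathrm{pr}_w(\sigma_T)$ is a bijection from the surviving combinatorial types onto the set of cones of this subdivision, which preserves and reflects inclusions of cones ($\sigma_T\subseteq\sigma_{T'}$ if and only if $\mathrm{pr}_w(\sigma_T)\subseteq\mathrm{pr}_w(\sigma_{T'})$). For every surviving $T$, $\mathrm{pr}_w$ maps the points of the lattice generated by all $v_I$ that lie in the linear span of $\sigma_T$ onto the points of the lattice $\mathbb{Z}^{E(G(w))}/\mathbb{Z}(1,\dots,1)$ that lie in the linear span of $\mathrm{pr}_w(\sigma_T)$; so the equality also holds for the weighted fans with all weights $1$. -/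

import Mathlib

noncomputable section

/-! ### The cycle matroid of a finite simple graph -/

/-- If `I` and `J` are edge sets of forests and every edge of `J` joins two vertices that are
connected by `I`, then `J` has at most as many edges as `I`. -/
theorem forest_ncard_le {V : Type*} [Finite V] (I : Set (Sym2 V)) (k : ℕ) :
    ∀ J : Set (Sym2 V), J ⊆ Sym2.diagSetᶜ → (SimpleGraph.fromEdgeSet J).IsAcyclic →
      (∀ a b, s(a, b) ∈ J → (SimpleGraph.fromEdgeSet I).Reachable a b) →
      (J \ I).ncard = k → J.ncard ≤ I.ncard := by
  induction k with
  | zero =>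
    intro J _ _ _ hk
    have hJI : J ⊆ I := by
      rw [Set.ncard_eq_zero] at hk
      exact Set.sdiff_eq_empty.mp hk
    exact Set.ncard_le_ncard hJI
  | succ k ih =>
    intro J hJd hJ hJI hk
    have hne : (J \ I).Nonempty := by
      rw [← Set.ncard_pos]; omega
    obtain ⟨e, heJ, heI⟩ := hne
    induction e using Sym2.ind with
    | _ a b =>
    have hab : a ≠ b := by
      intro h
      exact hJd heJ (by simp [h])
    have hbr : ¬ (SimpleGraph.fromEdgeSet (J \ {s(a, b)})).Reachable a b := by
      have h1 := (SimpleGraph.isAcyclic_iff_forall_isBridge.mp hJ) (e := s(a, b))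
        (by simp [heJ, hab])
      rw [SimpleGraph.isBridge_iff, SimpleGraph.deleteEdges_fromEdgeSet] at h1
      exact h1
    obtain ⟨c, d, hcdI, hcd⟩ : ∃ c d, s(c, d) ∈ I ∧
        ¬ (SimpleGraph.fromEdgeSet (J \ {s(a, b)})).Reachable c d := by
      by_contra hcon
      push Not at hcon
      apply hbr
      obtain ⟨p⟩ := hJI a b heJ
      clear hbr hk heI heJ hab
      generalize SimpleGraph.fromEdgeSet (J \ {s(a, b)}) = H at hcon ⊢
      induction p with
      | nil => exact SimpleGraph.Reachable.refl _
      | @cons u v w huv _ ihp =>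
        have huvI : s(u, v) ∈ I := by
          have := huv
          rw [SimpleGraph.fromEdgeSet_adj] at this
          exact this.1
        exact (hcon u v huvI).trans ihp
    have hcd' : c ≠ d := by
      rintro rfl
      exact hcd (SimpleGraph.Reachable.refl _)
    have hcdJ : s(c, d) ∉ J \ {s(a, b)} := by
      intro h
      exact hcd (SimpleGraph.Adj.reachable (by
        rw [SimpleGraph.fromEdgeSet_adj]; exact ⟨h, hcd'⟩))
    have hne' : s(c, d) ≠ s(a, b) := fun h => heI (h ▸ hcdI)
    have hcdJ' : s(c, d) ∉ J := fun h => hcdJ ⟨h, hne'⟩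
    have hcard : (insert s(c, d) (J \ {s(a, b)})).ncard = J.ncard := by
      rw [Set.ncard_insert_of_notMem hcdJ, Set.ncard_sdiff_singleton_add_one heJ]
    rw [← hcard]
    apply ih
    · rintro e (rfl | he)
      · simpa using hcd'
      · exact hJd he.1
    · have h2 : (SimpleGraph.fromEdgeSet (J \ {s(a, b)})).IsAcyclic :=
        hJ.anti (SimpleGraph.fromEdgeSet_mono Set.sdiff_subset)
      have h3 := h2.sup_edge_of_not_reachable hcd
      refine h3.anti ?_
      rw [Set.insert_eq, SimpleGraph.fromEdgeSet_union, sup_comm]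
      exact le_rfl
    · rintro x y (h | h)
      · have : s(x, y) ∈ I := h ▸ hcdI
        by_cases hxy : x = y
        · subst hxy; exact SimpleGraph.Reachable.refl _
        · exact SimpleGraph.Adj.reachable (by
            rw [SimpleGraph.fromEdgeSet_adj]; exact ⟨this, hxy⟩)
      · exact hJI x y h.1
    · have hset : insert s(c, d) (J \ {s(a, b)}) \ I = (J \ I) \ {s(a, b)} := by
        ext e
        simp only [Set.mem_sdiff, Set.mem_insert_iff, Set.mem_singleton_iff]
        constructor
        · rintro ⟨rfl | ⟨h1, h2⟩, h3⟩
          · exact absurd hcdI h3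
          · exact ⟨⟨h1, h3⟩, h2⟩
        · rintro ⟨⟨h1, h3⟩, h2⟩
          exact ⟨Or.inr ⟨h1, h2⟩, h3⟩
      rw [hset]
      have := Set.ncard_sdiff_singleton_add_one (s := J \ I) (a := s(a, b)) ⟨heJ, heI⟩
      omega

/-- The cycle matroid `M_G` of a finite simple graph `G`: its ground set is the edge set of `G`,
and a set of edges is independent if it contains no cycle. -/
def cycleMatroid {V : Type*} [Finite V] (G : SimpleGraph V) : Matroid (Sym2 V) :=
  (IndepMatroid.ofFinite (E := G.edgeSet) (Set.toFinite _)
    (fun I => I ⊆ G.edgeSet ∧ (SimpleGraph.fromEdgeSet I).IsAcyclic)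
    ⟨Set.empty_subset _, by simp⟩
    (fun _ _ hJ hIJ => ⟨hIJ.trans hJ.1, hJ.2.anti (SimpleGraph.fromEdgeSet_mono hIJ)⟩)
    (by
      intro I J hI hJ hlt
      by_contra hcon
      push Not at hcon
      have hd : G.edgeSet ⊆ Sym2.diagSetᶜ := by
        intro e he hdiag
        exact G.not_isDiag_of_mem_edgeSet he (by simpa using hdiag)
      refine absurd (forest_ncard_le I _ J (hJ.1.trans hd) hJ.2 ?_ rfl)
        (not_le.mpr hlt)
      intro a b hab
      by_contra hr
      have hnot : s(a, b) ∉ I := by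
        intro h
        refine hr (SimpleGraph.Adj.reachable ?_)
        rw [SimpleGraph.fromEdgeSet_adj]
        exact ⟨h, by rintro rfl; exact hr (SimpleGraph.Reachable.refl _)⟩
      refine hcon _ hab hnot (Set.insert_subset (hJ.1 hab) hI.1) ?_
      refine (hI.2.sup_edge_of_not_reachable hr).anti ?_
      rw [Set.insert_eq, SimpleGraph.fromEdgeSet_union, sup_comm]
      exact le_rfl)
    (fun _ hI => hI.1)).matroid

/-! ### Bergman fans and nested sets -/

section Bergman

variable {α : Type*}

/-- The weight `∑_{i ∈ B} x_i` of a set `B` of elements of a (finite) matroid. -/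
def setWeight (M : Matroid α) (x : M.E → ℝ) (B : Set α) : ℝ :=
  ∑ᶠ e ∈ {e : M.E | (e : α) ∈ B}, x e

/-- `B` is a base of `M` of minimal `x`-weight, that is, a base of the matroid `M_x`. -/
def IsMinWeightBase (M : Matroid α) (x : M.E → ℝ) (B : Set α) : Prop :=
  M.IsBase B ∧ ∀ B', M.IsBase B' → setWeight M x B ≤ setWeight M x B'

/-- The Bergman fan `B(M)`: all `x` for which `M_x` is loop-free, that is, for which every
element of the ground set lies in some base of minimal `x`-weight. -/
def bergmanFan (M : Matroid α) : Set (M.E → ℝ) :=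
  {x | ∀ e : M.E, ∃ B, IsMinWeightBase M x B ∧ (e : α) ∈ B}

/-- The line `L` spanned by `(1, …, 1)`. -/
def lineality (M : Matroid α) : Submodule ℝ (M.E → ℝ) :=
  Submodule.span ℝ {fun _ => 1}

/-- The ambient space `ℝ^E / L` of the reduced Bergman fan. -/
abbrev BergmanSpace (M : Matroid α) : Type _ := (M.E → ℝ) ⧸ lineality M

/-- The reduced Bergman fan `B'(M) = B(M) / L`. -/
def reducedBergmanFan (M : Matroid α) : Set (BergmanSpace M) :=
  (lineality M).mkQ '' bergmanFan M

/-- The lattice `ℤ^E / ℤ (1, …, 1)` in `ℝ^E / L`. -/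
def bergmanLattice (M : Matroid α) : Set (BergmanSpace M) :=
  (lineality M).mkQ '' {x | ∀ e, ∃ k : ℤ, x e = k}

/-- The class in `ℝ^E / L` of the vector `v_F = - ∑_{i ∈ F} e_i`. -/
def flatVec (M : Matroid α) (F : Set α) : BergmanSpace M :=
  (lineality M).mkQ fun e => -(F.indicator (fun _ => (1 : ℝ)) (e : α))

/-- `S` is nested with respect to the set `𝒢` of flats of `M`: it is a subset of `𝒢`, and the
join (in the lattice of flats) of any at least two pairwise incomparable elements of `S` is
not in `𝒢`. -/
def IsNested (M : Matroid α) (𝒢 S : Set (Set α)) : Prop :=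
  S ⊆ 𝒢 ∧ ∀ A ⊆ S, A.Nontrivial → IsAntichain (· ⊆ ·) A → M.closure (⋃₀ A) ∉ 𝒢

/-- The cone in `ℝ^E / L` spanned by the vectors `v_F`, `F ∈ S`. -/
def nestedCone (M : Matroid α) (S : Set (Set α)) : PointedCone ℝ (BergmanSpace M) :=
  PointedCone.hull ℝ (flatVec M '' S)

/-- The cones of the nested set subdivision of `B'(M)` with respect to `𝒢`. -/
def nestedSubdivision (M : Matroid α) (𝒢 : Set (Set α)) :
    Set (PointedCone ℝ (BergmanSpace M)) :=
  {τ | ∃ S, IsNested M 𝒢 S ∧ τ = nestedCone M S}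

end Bergman

/-- The 1-connected flats of the cycle matroid of `G`: the flats `F` such that the graph with edge
set `F`, on the vertices that are incident with an edge of `F`, is connected. (A connected graph
has a vertex, so the empty flat is excluded.) -/
def oneConnectedFlats {V : Type*} [Finite V] (G : SimpleGraph V) : Set (Set (Sym2 V)) :=
  {F | (cycleMatroid G).IsFlat F ∧
    ((SimpleGraph.fromEdgeSet F).induce (SimpleGraph.fromEdgeSet F).support).Connected}

/-! ### Tropical curves -/

/-- A combinatorial type of `n`-marked rational tropical curves: a finite tree whose edges are the
bounded edges, together with the vertex `mark i` to which the `i`-th end is attached, such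
that every vertex has valence at least three. -/
structure CombType (n : ℕ) where
  /-- the vertices -/
  V : Type
  finite : Finite V
  /-- the tree formed by the bounded edges -/
  graph : SimpleGraph V
  isTree : graph.IsTree
  /-- the vertex to which the `i`-th end is attached -/
  mark : Fin n → V
  three_le_valence : ∀ v, 3 ≤ (graph.neighborSet v).ncard + {i | mark i = v}.ncard

/-- Isomorphism of combinatorial types: an isomorphism of trees that respects the marked ends. -/
def CombType.Iso {n : ℕ} (T T' : CombType n) : Prop :=
  ∃ f : T.graph ≃g T'.graph, ∀ i, f (T.mark i) = T'.mark i

/-- An abstract `n`-marked rational tropical curve: a combinatorial type with a positive length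
for each bounded edge. -/
structure TropicalCurve (n : ℕ) extends CombType n where
  /-- the length of the bounded edges (the values elsewhere are irrelevant) -/
  length : Sym2 V → ℝ
  length_pos : ∀ e ∈ graph.edgeSet, 0 < length e

/-- The length of the path between two vertices of a tropical curve. -/
def TropicalCurve.dist {n : ℕ} (C : TropicalCurve n) (u v : C.V) : ℝ :=
  ((C.isTree.existsUnique_path u v).choose.edges.map C.length).sum

theorem TropicalCurve.dist_comm {n : ℕ} (C : TropicalCurve n) (u v : C.V) :
    C.dist u v = C.dist v u := by
  have hp := (C.isTree.existsUnique_path u v).choose_spec.1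
  have hq := (C.isTree.existsUnique_path v u).choose_spec.2
  have h := hq _ hp.reverse
  unfold TropicalCurve.dist
  rw [← h, SimpleGraph.Walk.edges_reverse, List.map_reverse, List.sum_reverse]

/-- The space of functions on the two-element subsets of `{1, …, n}`. -/
abbrev PairSpace (n : ℕ) : Type := (⊤ : SimpleGraph (Fin n)).edgeSet → ℝ

/-- The vector `(f i j)_{i < j}` given by a symmetric function `f`. -/
def pairVec {n : ℕ} (f : Fin n → Fin n → ℝ) (hf : ∀ i j, f i j = f j i) : PairSpace n :=
  fun e => Sym2.lift ⟨f, hf⟩ (e : Sym2 (Fin n))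

/-- The map `Φ(x) = (x_i + x_j)_{i < j}`. -/
def leafShift (n : ℕ) : (Fin n → ℝ) →ₗ[ℝ] PairSpace n where
  toFun x := pairVec (fun i j => x i + x j) fun i j => add_comm (x i) (x j)
  map_add' x y := by
    ext ⟨e, he⟩
    induction e using Sym2.ind with
    | _ i j => simp [pairVec]; ring
  map_smul' c x := by
    ext ⟨e, he⟩
    induction e using Sym2.ind with
    | _ i j => simp [pairVec]; ring

/-- The ambient space `ℝ^(n choose 2) / Φ(ℝ^n)` of the moduli space of tropical curves. -/
abbrev CurveSpace (n : ℕ) : Type := PairSpace n ⧸ LinearMap.range (leafShift n)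

/-- The vector `d(C)` of the distances between the ends of `C`. -/
def TropicalCurve.distVec {n : ℕ} (C : TropicalCurve n) : CurveSpace n :=
  (LinearMap.range (leafShift n)).mkQ
    (pairVec (fun i j => C.dist (C.mark i) (C.mark j)) fun i j =>
      C.dist_comm (C.mark i) (C.mark j))

/-- The embedded moduli space `M_{0,n}^trop` of `n`-marked rational tropical curves. -/
def tropicalModuli (n : ℕ) : Set (CurveSpace n) :=
  Set.range TropicalCurve.distVec

open Classical in
/-- The vector `v_I` of the curve with a single bounded edge, of length one, inducing the split
`I ⊔ Iᶜ` of the ends: the distance of `i` and `j` is one if the split separates them. -/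
def splitVec {n : ℕ} (I : Set (Fin n)) : CurveSpace n :=
  (LinearMap.range (leafShift n)).mkQ
    (pairVec (fun i j => if (i ∈ I ↔ j ∈ I) then 0 else 1) fun i j => by simp only [iff_comm])

/-- The lattice generated by the vectors `v_I`. -/
def curveLattice (n : ℕ) : AddSubgroup (CurveSpace n) :=
  AddSubgroup.closure (Set.range splitVec)

namespace CombType

variable {n : ℕ}

/-- The set of ends on the side of `v` of an edge `uv`. -/
def side (T : CombType n) (u v : T.V) : Set (Fin n) :=
  {i | (T.graph.deleteEdges {s(u, v)}).Reachable v (T.mark i)}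

/-- The cone of a combinatorial type, spanned by the vectors `v_I` for the splits `I` induced by
its bounded edges. -/
def cone (T : CombType n) : PointedCone ℝ (CurveSpace n) :=
  PointedCone.hull ℝ {x | ∃ u v, T.graph.Adj u v ∧ x = splitVec (T.side u v)}

/-- A combinatorial type is top-dimensional if it has `n - 3` bounded edges. -/
def IsTop (T : CombType n) : Prop := T.graph.edgeSet.ncard + 3 = n

end CombType

/-! ### Weight graphs and the projection -/

/-- `i` is heavy in `w` if `w_i + w_j > 1` for all `j ≠ i`. -/
def IsHeavy {n : ℕ} (w : Fin n → ℚ) (i : Fin n) : Prop := ∀ j, j ≠ i → 1 < w i + w j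

/-- The total weight graph `G_t(w)`: distinct `i` and `j` are adjacent iff `w_i + w_j > 1`. -/
def totalWeightGraph {n : ℕ} (w : Fin n → ℚ) : SimpleGraph (Fin n) where
  Adj i j := i ≠ j ∧ 1 < w i + w j
  symm := ⟨fun i j hij => ⟨hij.1.symm, by rw [add_comm]; exact hij.2⟩⟩
  loopless := ⟨fun _ hi => hi.1 rfl⟩

/-- The markings other than `h`. -/
abbrev Others {n : ℕ} (h : Fin n) : Type := {i : Fin n // i ≠ h}

/-- The complete graph on the markings other than `h` (a `K_{n-1}`). -/
abbrev completeOthers {n : ℕ} (h : Fin n) : SimpleGraph (Others h) := ⊤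

/-- The reduced weight graph `G(w)`, obtained from `G_t(w)` by deleting the vertex `h`. -/
def reducedWeightGraph {n : ℕ} (w : Fin n → ℚ) (h : Fin n) : SimpleGraph (Others h) :=
  (totalWeightGraph w).comap Subtype.val

section Projection

variable {n : ℕ} (h : Fin n)

/-- The linear map `d ↦ ((d_{ij} - d_{hi} - d_{hj}) / 2)_{ij}` from `ℝ^(n choose 2)` to the space of
functions on the edges `ij` of the complete graph on the markings other than `h`. -/
def gromovMap : PairSpace n →ₗ[ℝ] ((cycleMatroid (completeOthers h)).E → ℝ) where
  toFun d e :=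
    (d ⟨(e : Sym2 (Others h)).map Subtype.val, by
        obtain ⟨e, he⟩ := e
        induction e using Sym2.ind with
        | _ i j =>
          have hij : i ≠ j := SimpleGraph.Adj.ne (G := completeOthers h) he
          simpa using fun hv => hij (Subtype.ext hv)⟩
      - ∑ i ∈ (e : Sym2 (Others h)).toFinset, d ⟨s(h, i.1), by simpa using i.2.symm⟩) / 2
  map_add' d d' := by
    ext e
    simp [Finset.sum_add_distrib]
    ring
  map_smul' c d := by
    ext e
    simp [← Finset.mul_sum]
    ring

theorem gromovMap_leafShift (x : Fin n → ℝ) :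
    gromovMap h (leafShift n x) = -x h • fun _ => (1 : ℝ) := by
  ext ⟨e, he⟩
  induction e using Sym2.ind with
  | _ i j =>
    have hij : i ≠ j := SimpleGraph.Adj.ne (G := completeOthers h) he
    simp [gromovMap, leafShift, pairVec, Sym2.toFinset_mk_eq, Finset.sum_pair hij]
    ring

/-- The isomorphism of `ℝ^(n choose 2) / Φ(ℝ^n)` with `ℝ^E(K_{n-1}) / L` that sends `v_I`, for
`h ∉ I`, to `v_F`, where `F` is the set of edges of `K_{n-1}` between elements of `I`; it identifies
`M_{0,n}^trop` with `B'(K_{n-1})`. -/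
def moduliToBergman : CurveSpace n →ₗ[ℝ] BergmanSpace (cycleMatroid (completeOthers h)) :=
  Submodule.mapQ _ _ (gromovMap h) (by
    rintro _ ⟨x, rfl⟩
    rw [Submodule.mem_comap, gromovMap_leafShift]
    exact Submodule.smul_mem _ _ (Submodule.subset_span rfl))

variable (w : Fin n → ℚ)

/-- The projection `ℝ^E(K_{n-1}) / L → ℝ^E(G(w)) / L` forgetting the coordinates of the edges that
are not in `G(w)`. -/
def forgetEdges : BergmanSpace (cycleMatroid (completeOthers h)) →ₗ[ℝ]
    BergmanSpace (cycleMatroid (reducedWeightGraph w h)) :=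
  Submodule.mapQ _ _
    (LinearMap.funLeft ℝ ℝ fun e : (cycleMatroid (reducedWeightGraph w h)).E =>
      (⟨e.1, SimpleGraph.edgeSet_mono (le_top : reducedWeightGraph w h ≤ completeOthers h) e.2⟩ :
        (cycleMatroid (completeOthers h)).E))
    (by
      rw [lineality, Submodule.span_le, Set.singleton_subset_iff]
      exact Submodule.subset_span rfl)

/-- The projection `pr_w`. -/
def prW : CurveSpace n →ₗ[ℝ] BergmanSpace (cycleMatroid (reducedWeightGraph w h)) :=
  forgetEdges h w ∘ₗ moduliToBergman h

/-- A combinatorial type survives under `pr_w` if its cone is a face of the cone of a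
top-dimensional combinatorial type on which `pr_w` is injective. -/
def Survives (T : CombType n) : Prop :=
  ∃ T' : CombType n, T'.IsTop ∧ Set.InjOn (prW h w) T'.cone ∧ T.cone ≤ T'.cone

end Projection

end

/-!
Rooting a combinatorial type at the end `h`, each bounded edge has a side not containing `h`, its
*clade*. The clades form a laminar family of subsets of `{h}ᶜ`, each with at least two elements
and different from `{h}ᶜ`; every such family occurs (`CombType.exists_clades_eq`), the family
determines the type up to isomorphism (`CombType.iso_of_clades_eq`), and the distance vector of a
curve is the sum of the `v_I` over the clades `I`, weighted by the lengths of the edges.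

The reduced weight graph is a threshold graph: an induced subgraph without isolated vertices has a
vertex, the one of largest weight, that is adjacent to all others (`IsStar`). Hence the
1-connected flats are the edge sets `E(I)` of the stars `I`, and a set of such flats is nested if
and only if the stars form a laminar family. For `h ∉ I` the projection sends `v_I` to the ray of
the flat `E(I)`, which is `E(J)` for the set `J` of vertices that are not isolated in `I`, or zero
if there are none. The second heavy entry makes `{h}ᶜ` itself a star, so that the whole edge set
is one of these flats.

A star is not covered by smaller members of a laminar family (`exists_edge_forall_subset`).
Reading off coordinates at the uncovered edges shows that the coefficients with respect to the
rays of a nested cone lie in every subgroup of `ℝ` containing the coordinates of the vector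
(`coeff_mem`), and that a ray in a nested cone is one of its generators
(`mem_of_rayVec_mem_hull`). The first gives injectivity and the statement on lattices; the second
identifies inclusions of cones with inclusions of families, for the complete graph also on the
side of the moduli space.

The surviving types are those whose clades are all stars (`survives_iff`). On one hand, in a
trivalent tree a smallest clade that is not a star arises from a smaller one by adding an isolated
vertex, and then the projection identifies two vectors. On the other hand a maximal family of
stars is trivalent, because at a vertex of higher valence the branch containing the centre of the
star can be united with another one.

Finally, a vector is in the Bergman fan of a cycle matroid if and only if no edge is spanned by
lighter ones. For images of distance vectors this is an ultrametric inequality; conversely, a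
vector of the fan is decomposed along the components of its sublevel graphs
(`mkQ_mem_hull_levelFamily`).
-/

noncomputable section

/-! ### Rooted trees -/

/-- The graph `G` is the tree with root `r` in which `p v` is the parent of every `v ≠ r`. The root
is its own parent, and the existence of a depth function excludes cycles of parents. -/
structure RootedBy {V : Type*} (G : SimpleGraph V) (r : V) (p : V → V) : Prop where
  root : p r = r
  adj_iff : ∀ a b, G.Adj a b ↔ (a ≠ r ∧ p a = b) ∨ (b ≠ r ∧ p b = a)
  depth : ∃ d : V → ℕ, ∀ v, v ≠ r → d (p v) < d v

/-- `z` is an ancestor of `x` (possibly `x` itself) for the parent function `p`. -/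
def Anc {V : Type*} (p : V → V) (z x : V) : Prop := ∃ k : ℕ, p^[k] x = z

section Anc

variable {V : Type*} {p : V → V}

theorem Anc.refl (p : V → V) (x : V) : Anc p x x := ⟨0, rfl⟩

theorem anc_parent (p : V → V) (x : V) : Anc p (p x) x := ⟨1, rfl⟩

theorem Anc.trans {a b c : V} (hab : Anc p a b) (hbc : Anc p b c) : Anc p a c := by
  obtain ⟨k, rfl⟩ := hab
  obtain ⟨l, rfl⟩ := hbc
  exact ⟨k + l, by rw [Function.iterate_add_apply]⟩

theorem Anc.eq_or_anc_parent {z x : V} (hz : Anc p z x) : z = x ∨ Anc p z (p x) := by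
  obtain ⟨_ | k, rfl⟩ := hz
  · exact Or.inl rfl
  · exact Or.inr ⟨k, rfl⟩

theorem Anc.total {z z' x : V} (hz : Anc p z x) (hz' : Anc p z' x) : Anc p z z' ∨ Anc p z' z := by
  obtain ⟨k, rfl⟩ := hz
  obtain ⟨l, rfl⟩ := hz'
  rcases le_total k l with hkl | hkl
  · obtain ⟨m, rfl⟩ := Nat.exists_eq_add_of_le hkl
    exact Or.inr ⟨m, by rw [← Function.iterate_add_apply, add_comm]⟩
  · obtain ⟨m, rfl⟩ := Nat.exists_eq_add_of_le hkl
    exact Or.inl ⟨m, by rw [← Function.iterate_add_apply, add_comm]⟩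

end Anc

namespace RootedBy

variable {V : Type*} {G : SimpleGraph V} {r : V} {p : V → V}

theorem adj_parent (H : RootedBy G r p) {v : V} (hv : v ≠ r) : G.Adj v (p v) :=
  (H.adj_iff _ _).2 (Or.inl ⟨hv, rfl⟩)

theorem root_anc (H : RootedBy G r p) (x : V) : Anc p r x := by
  obtain ⟨d, hd⟩ := H.depth
  induction hn : d x using Nat.strong_induction_on generalizing x with
  | _ n ih =>
    by_cases hx : x = r
    · subst hx; exact Anc.refl _ _
    · exact (ih _ (hn ▸ hd x hx) _ rfl).trans (anc_parent p x)

theorem eq_root_of_anc_root (H : RootedBy G r p) {z : V} (hz : Anc p z r) : z = r := by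
  obtain ⟨k, rfl⟩ := hz
  exact Function.iterate_fixed H.root k

theorem exists_child (H : RootedBy G r p) {z x : V} (hz : Anc p z x) (hne : z ≠ x) :
    ∃ c, c ≠ r ∧ p c = z ∧ Anc p c x := by
  obtain ⟨k, hk⟩ := hz
  induction k with
  | zero => exact absurd hk.symm hne
  | succ k ih =>
    rw [Function.iterate_succ_apply'] at hk
    by_cases hr : p^[k] x = r
    · refine ih ?_
      rw [hr, H.root] at hk
      rw [hr, hk]
    · exact ⟨p^[k] x, hr, hk, k, rfl⟩

theorem exists_depth (H : RootedBy G r p) :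
    ∃ d : V → ℕ, ∀ z x, Anc p z x → z ≠ x → d z < d x := by
  obtain ⟨d, hd⟩ := H.depth
  refine ⟨d, ?_⟩
  rintro z x ⟨k, rfl⟩ hne
  have key : ∀ k, d (p^[k] x) ≤ d x := by
    intro k
    induction k with
    | zero => exact le_rfl
    | succ k ih =>
      rw [Function.iterate_succ_apply']
      by_cases hr : p^[k] x = r
      · rw [hr, H.root, ← hr]; exact ih
      · exact (hd _ hr).le.trans ih
  have hxr : x ≠ r := by
    rintro rfl
    exact hne (Function.iterate_fixed H.root k)
  cases k with
  | zero => exact absurd rfl hne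
  | succ k =>
    clear hne
    induction k with
    | zero => exact hd x hxr
    | succ k ih =>
      rw [Function.iterate_succ_apply']
      by_cases hr : p^[k + 1] x = r
      · rw [hr, H.root, ← hr]; exact ih
      · exact (hd _ hr).trans ih

theorem anc_antisymm (H : RootedBy G r p) {a b : V} (hab : Anc p a b) (hba : Anc p b a) :
    a = b := by
  obtain ⟨d, hd⟩ := H.exists_depth
  by_contra hne
  exact lt_asymm (hd _ _ hab hne) (hd _ _ hba (Ne.symm hne))

theorem not_anc_parent (H : RootedBy G r p) {c : V} (hc : c ≠ r) : ¬ Anc p c (p c) := by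
  intro hcp
  have := H.anc_antisymm hcp (anc_parent p c)
  exact (H.adj_parent hc).ne this

/-- An edge other than the one from `c` to its parent joins two descendants of `c` or two
non-descendants. -/
theorem anc_iff_of_adj (H : RootedBy G r p) {a b c : V} (hab : G.Adj a b)
    (hne : s(a, b) ≠ s(c, p c)) : Anc p c a ↔ Anc p c b := by
  have key : ∀ a b : V, a ≠ r → p a = b → s(a, b) ≠ s(c, p c) → (Anc p c a ↔ Anc p c b) := by
    rintro a _ har rfl hne
    constructor
    · intro hca
      rcases hca.eq_or_anc_parent with rfl | h1
      · exact absurd rfl hne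
      · exact h1
    · intro hcb
      exact hcb.trans (anc_parent p a)
  rcases (H.adj_iff a b).1 hab with ⟨h1, h2⟩ | ⟨h1, h2⟩
  · exact key a b h1 h2 hne
  · exact (key b a h1 h2 (by rwa [Sym2.eq_swap])).symm

theorem anc_iff_of_reachable (H : RootedBy G r p) {a b c : V}
    (hab : (G.deleteEdges {s(c, p c)}).Reachable a b) : Anc p c a ↔ Anc p c b := by
  obtain ⟨q⟩ := hab
  induction q with
  | nil => exact Iff.rfl
  | cons hadj _ ih =>
    rw [SimpleGraph.deleteEdges_adj] at hadj
    exact (H.anc_iff_of_adj hadj.1 hadj.2).trans ih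

/-- The path along parents from `x` up to its ancestor `z` avoids the edge from `c` to its parent,
provided that `c` is not a vertex of this path below `z`. -/
theorem reachable_of_anc (H : RootedBy G r p) {c x z : V} (hz : Anc p z x)
    (hc : ∀ y, Anc p y x → Anc p z y → y ≠ z → y ≠ c) :
    (G.deleteEdges {s(c, p c)}).Reachable z x := by
  obtain ⟨d, hd⟩ := H.exists_depth
  induction hn : d x using Nat.strong_induction_on generalizing x with
  | _ n ih =>
    by_cases hzx : z = x
    · subst hzx; exact SimpleGraph.Reachable.refl _
    · have hxr : x ≠ r := by
        rintro rfl
        exact hzx (H.eq_root_of_anc_root hz)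
      have h1 : Anc p z (p x) := (hz.eq_or_anc_parent).resolve_left hzx
      have h2 := ih _ (hn ▸ hd _ _ (anc_parent p x) (H.adj_parent hxr).ne') h1
        (fun y hy => hc y (hy.trans (anc_parent p x))) rfl
      refine h2.trans (SimpleGraph.Adj.reachable ?_)
      rw [SimpleGraph.deleteEdges_adj]
      refine ⟨(H.adj_parent hxr).symm, ?_⟩
      have hxc := hc x (Anc.refl _ _) hz (Ne.symm hzx)
      intro he
      rw [Set.mem_singleton_iff, Sym2.eq_iff] at he
      rcases he with ⟨h3, h4⟩ | ⟨h3, h4⟩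
      · have := anc_parent p c
        rw [← h4, ← h3] at this
        exact H.not_anc_parent hxr this
      · exact hxc h4

theorem reachable_self_iff (H : RootedBy G r p) {c x : V} :
    (G.deleteEdges {s(c, p c)}).Reachable c x ↔ Anc p c x :=
  ⟨fun h1 => (H.anc_iff_of_reachable h1).1 (Anc.refl _ _),
    fun h1 => H.reachable_of_anc h1 (fun _ _ _ hne => hne)⟩

theorem reachable_parent_iff (H : RootedBy G r p) {c x : V} (hc : c ≠ r) :
    (G.deleteEdges {s(c, p c)}).Reachable (p c) x ↔ ¬ Anc p c x := by
  constructor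
  · intro h1 h2
    exact H.not_anc_parent hc ((H.anc_iff_of_reachable h1).2 h2)
  · intro h1
    have key : ∀ y, ¬ Anc p c y → (G.deleteEdges {s(c, p c)}).Reachable r y := by
      intro y hy
      refine H.reachable_of_anc (H.root_anc y) ?_
      rintro z hz _ _ rfl
      exact hy hz
    exact (key _ (H.not_anc_parent hc)).symm.trans (key _ h1)

/-- A walk that avoids one of the endpoints of an edge of the tree stays on the side on which it
begins. -/
theorem anc_iff_of_walk (H : RootedBy G r p) {a b c : V} (q : G.Walk a b)
    (hq : c ∉ q.support ∨ p c ∉ q.support) : Anc p c a ↔ Anc p c b := by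
  induction q with
  | nil => exact Iff.rfl
  | @cons u v w hadj q ih =>
    rw [SimpleGraph.Walk.support_cons, List.mem_cons, List.mem_cons, not_or, not_or] at hq
    refine (H.anc_iff_of_adj hadj ?_).trans (ih (hq.imp And.right And.right))
    intro he
    have hv := q.start_mem_support
    rw [Sym2.eq_iff] at he
    rcases he with ⟨rfl, rfl⟩ | ⟨rfl, rfl⟩ <;> tauto

open Classical in
/-- The length of a path in a rooted tree: the edge from `v` to its parent is on the path from `a`
to `b` if exactly one of `a` and `b` is a descendant of `v`. -/
theorem sum_edges_eq (H : RootedBy G r p) [Fintype V] (len : Sym2 V → ℝ) {a b : V}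
    (q : G.Walk a b) (hq : q.IsPath) :
    (q.edges.map len).sum =
      ∑ v, if v ≠ r ∧ ¬ (Anc p v a ↔ Anc p v b) then len s(v, p v) else 0 := by
  induction q with
  | nil => simp
  | @cons u v w hadj q ih =>
    rw [SimpleGraph.Walk.cons_isPath_iff] at hq
    rw [SimpleGraph.Walk.edges_cons, List.map_cons, List.sum_cons, ih hq.1]
    obtain ⟨c, hcr, hc, huw⟩ : ∃ c, c ≠ r ∧ s(u, v) = s(c, p c) ∧
        ¬ (Anc p c u ↔ Anc p c w) ∧ (Anc p c v ↔ Anc p c w) := by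
      rcases (H.adj_iff u v).1 hadj with ⟨h1, rfl⟩ | ⟨h1, rfl⟩
      · have h2 := H.anc_iff_of_walk q (Or.inl hq.2)
        refine ⟨u, h1, rfl, ?_, h2⟩
        have := H.not_anc_parent h1
        have := Anc.refl p u
        tauto
      · have h2 := H.anc_iff_of_walk q (Or.inr hq.2)
        refine ⟨v, h1, Sym2.eq_swap, ?_, h2⟩
        have := H.not_anc_parent h1
        have := Anc.refl p v
        tauto
    have hrest : ∀ z, z ≠ c → z ≠ r → (Anc p z u ↔ Anc p z v) := by
      intro z hz hzr
      refine H.anc_iff_of_adj hadj ?_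
      rw [hc]
      intro he
      rw [Sym2.eq_iff] at he
      rcases he with ⟨h3, -⟩ | ⟨h3, h4⟩
      · exact hz h3.symm
      · have := anc_parent p z
        rw [← h3] at this
        exact hz (H.anc_antisymm (h4 ▸ anc_parent p c) this)
    rw [← Finset.add_sum_erase _ _ (Finset.mem_univ c),
      ← Finset.add_sum_erase (s := Finset.univ) (a := c) (f := fun v_1 =>
        if v_1 ≠ r ∧ ¬ (Anc p v_1 u ↔ Anc p v_1 w) then len s(v_1, p v_1) else 0)
        (Finset.mem_univ c), if_neg (by tauto), if_pos ⟨hcr, huw.1⟩, hc, zero_add]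
    congr 1
    refine Finset.sum_congr rfl fun z hz => ?_
    by_cases hzr : z = r
    · simp [hzr]
    · rw [hrest z (Finset.ne_of_mem_erase hz) hzr]

end RootedBy

/-- In a tree, every vertex other than the root has exactly one neighbour that is closer to the
root. -/
theorem SimpleGraph.IsTree.exists_rootedBy {V : Type*} {G : SimpleGraph V} (hG : G.IsTree)
    (r : V) : ∃ p, RootedBy G r p := by
  classical
  have hex : ∀ v, v ≠ r → ∃ u, G.Adj v u ∧ G.dist r v = G.dist r u + 1 := by
    intro v hv
    obtain ⟨q, hq⟩ := hG.connected.exists_walk_length_eq_dist v r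
    cases q with
    | nil => exact absurd rfl hv
    | @cons _ u _ hadj q =>
      refine ⟨u, hadj, ?_⟩
      rcases hG.dist_eq_dist_add_one_of_adj r hadj with h1 | h1
      · exact h1
      · have h2 := SimpleGraph.dist_le q
        rw [SimpleGraph.Walk.length_cons, SimpleGraph.dist_comm] at hq
        rw [SimpleGraph.dist_comm] at h2
        omega
  have huniq : ∀ v u u', G.Adj v u → G.dist r v = G.dist r u + 1 → G.Adj v u' →
      G.dist r v = G.dist r u' + 1 → u = u' := by
    intro v u u' h1 h2 h3 h4
    have key : ∀ u, G.Adj v u → G.dist r v = G.dist r u + 1 →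
        ∃ q : G.Walk v r, q.IsPath ∧ q.snd = u := by
      intro u h1 h2
      obtain ⟨q, hq⟩ := hG.connected.exists_walk_length_eq_dist u r
      refine ⟨SimpleGraph.Walk.cons h1 q, ?_, by simp⟩
      apply SimpleGraph.Walk.isPath_of_length_eq_dist
      rw [SimpleGraph.Walk.length_cons, hq, G.dist_comm, G.dist_comm (u := v), h2]
    obtain ⟨q, hq, rfl⟩ := key u h1 h2
    obtain ⟨q', hq', rfl⟩ := key u' h3 h4
    rw [(hG.existsUnique_path v r).unique hq hq']
  choose! f hf using hex
  refine ⟨fun v => if v = r then r else f v, by simp, ?_, fun v => G.dist r v, ?_⟩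
  · intro a b
    constructor
    · intro hab
      rcases hG.dist_eq_dist_add_one_of_adj r hab with h1 | h1
      · have har : a ≠ r := by rintro rfl; simp at h1
        refine Or.inl ⟨har, ?_⟩
        rw [if_neg har]
        exact huniq a _ _ (hf a har).1 (hf a har).2 hab h1
      · have hbr : b ≠ r := by rintro rfl; simp at h1
        refine Or.inr ⟨hbr, ?_⟩
        rw [if_neg hbr]
        exact huniq b _ _ (hf b hbr).1 (hf b hbr).2 hab.symm h1
    · rintro (⟨h1, rfl⟩ | ⟨h1, rfl⟩)
      · rw [if_neg h1]; exact (hf a h1).1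
      · rw [if_neg h1]; exact (hf b h1).1.symm
  · intro v hv
    have := (hf v hv).2
    simp only [if_neg hv]
    omega

theorem RootedBy.isTree {V : Type*} [Finite V] {G : SimpleGraph V} {r : V} {p : V → V}
    (H : RootedBy G r p) : G.IsTree := by
  have hreach : ∀ v, G.Reachable r v := fun v =>
    (H.reachable_of_anc (c := r) (H.root_anc v) (fun _ _ _ hne => hne)).mono
      (SimpleGraph.deleteEdges_le _)
  have hconn : G.Connected :=
    { preconnected := fun a b => (hreach a).symm.trans (hreach b), nonempty := ⟨r⟩ }
  rw [SimpleGraph.isTree_iff_connected_and_card]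
  refine ⟨hconn, le_antisymm ?_ hconn.card_vert_le_card_edgeSet_add_one⟩
  have hsurj : Function.Surjective (fun v : {v // v ≠ r} =>
      (⟨s(v.1, p v.1), H.adj_parent v.2⟩ : G.edgeSet)) := by
    rintro ⟨e, he⟩
    induction e using Sym2.ind with
    | _ a b =>
      rcases (H.adj_iff a b).1 he with ⟨h1, h2⟩ | ⟨h1, h2⟩
      · exact ⟨⟨a, h1⟩, by simp [h2]⟩
      · exact ⟨⟨b, h1⟩, Subtype.ext (by simp [h2, Sym2.eq_swap])⟩
  have h1 : Nat.card G.edgeSet ≤ Nat.card {v // v ≠ r} :=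
    Nat.card_le_card_of_surjective _ hsurj
  have h2 : Nat.card {v // v ≠ r} + 1 = Nat.card V := by
    have := Set.ncard_add_ncard_compl ({r} : Set V)
    rw [Set.ncard_singleton] at this
    rw [← this, add_comm]
    rfl
  rw [← h2]
  exact Nat.add_le_add_right h1 1

/-! ### The clades of a combinatorial type -/

/-- Any two sets of the family are comparable or disjoint. -/
def IsLaminar {α : Type*} (𝓕 : Set (Set α)) : Prop :=
  ∀ I ∈ 𝓕, ∀ J ∈ 𝓕, I ⊆ J ∨ J ⊆ I ∨ Disjoint I J

/-- The families of sets of ends that arise as the sides not containing `h` of the bounded edges of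
a combinatorial type. -/
structure IsCladeFamily {n : ℕ} (h : Fin n) (𝓕 : Set (Set (Fin n))) : Prop where
  laminar : IsLaminar 𝓕
  notMem : ∀ I ∈ 𝓕, h ∉ I
  nontrivial : ∀ I ∈ 𝓕, I.Nontrivial
  ne_compl : ∀ I ∈ 𝓕, I ≠ {h}ᶜ

theorem IsCladeFamily.mono {n : ℕ} {h : Fin n} {𝓕 𝓕' : Set (Set (Fin n))}
    (h𝓕 : IsCladeFamily h 𝓕) (hle : 𝓕' ⊆ 𝓕) : IsCladeFamily h 𝓕' where
  laminar I hI J hJ := h𝓕.laminar I (hle hI) J (hle hJ)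
  notMem I hI := h𝓕.notMem I (hle hI)
  nontrivial I hI := h𝓕.nontrivial I (hle hI)
  ne_compl I hI := h𝓕.ne_compl I (hle hI)

namespace CombType

variable {n : ℕ}

instance (T : CombType n) : Finite T.V := T.finite

instance (T : CombType n) : Fintype T.V := Fintype.ofFinite T.V

/-- The sides not containing `h` of the bounded edges of `T`. -/
def clades (T : CombType n) (h : Fin n) : Set (Set (Fin n)) :=
  {I | h ∉ I ∧ ∃ u v, T.graph.Adj u v ∧ I = T.side u v}

/-- The ends attached to descendants of the vertex `v`, for the parent function `p`. -/
def below (T : CombType n) (p : T.V → T.V) (v : T.V) : Set (Fin n) := {i | Anc p v (T.mark i)}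

/-- The branches at the vertex `v` of the tree rooted at the end `h`: the children of `v` and the
ends other than `h` attached to `v`. -/
def branches (T : CombType n) (h : Fin n) (p : T.V → T.V) (v : T.V) : Set (T.V ⊕ Fin n) :=
  Sum.inl '' {c | c ≠ T.mark h ∧ p c = v} ∪ Sum.inr '' {i | i ≠ h ∧ T.mark i = v}

/-- The ends that belong to a branch. -/
def ends (T : CombType n) (p : T.V → T.V) : T.V ⊕ Fin n → Set (Fin n) :=
  Sum.elim (T.below p) fun i => {i}

section Rooted

variable {T : CombType n} {h : Fin n} {p : T.V → T.V}

/-- Besides the branches, a vertex is incident with the edge to its parent or, at the root, with the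
end `h`. -/
theorem valence_eq (H : RootedBy T.graph (T.mark h) p) (v : T.V) :
    (T.graph.neighborSet v).ncard + {i | T.mark i = v}.ncard = (T.branches h p v).ncard + 1 := by
  have h1 : (T.branches h p v).ncard =
      {c | c ≠ T.mark h ∧ p c = v}.ncard + {i | i ≠ h ∧ T.mark i = v}.ncard := by
    rw [branches, Set.ncard_union_eq, Set.ncard_image_of_injective _ Sum.inl_injective,
      Set.ncard_image_of_injective _ Sum.inr_injective]
    rw [Set.disjoint_left]
    rintro _ ⟨a, -, rfl⟩ ⟨b, -, hb⟩
    cases hb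
  rw [h1]
  by_cases hv : v = T.mark h
  · have h2 : T.graph.neighborSet v = {c | c ≠ T.mark h ∧ p c = v} := by
      ext c
      rw [SimpleGraph.mem_neighborSet, H.adj_iff]
      simp [hv]
    have h3 : {i | T.mark i = v} = insert h {i | i ≠ h ∧ T.mark i = v} := by
      ext i
      by_cases hi : i = h <;> simp [hi, hv]
    rw [h2, h3, Set.ncard_insert_of_notMem (by simp)]
    ring
  · have h2 : T.graph.neighborSet v = insert (p v) {c | c ≠ T.mark h ∧ p c = v} := by
      ext c
      rw [SimpleGraph.mem_neighborSet, H.adj_iff]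
      simp [hv, eq_comm]
    have h3 : {i | T.mark i = v} = {i | i ≠ h ∧ T.mark i = v} := by
      ext i
      simp only [Set.mem_ofPred_eq]
      constructor
      · rintro hi
        exact ⟨by rintro rfl; exact hv hi.symm, hi⟩
      · exact And.right
    rw [h2, ← h3, Set.ncard_insert_of_notMem]
    · ring
    · rintro ⟨-, h4⟩
      have := anc_parent p (p v)
      rw [h4] at this
      exact H.not_anc_parent hv this

theorem two_le_branches (H : RootedBy T.graph (T.mark h) p) (v : T.V) :
    2 ≤ (T.branches h p v).ncard := by
  have h1 := T.three_le_valence v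
  rw [valence_eq H] at h1
  omega

theorem notMem_ends (H : RootedBy T.graph (T.mark h) p) {v : T.V} {a : T.V ⊕ Fin n}
    (ha : a ∈ T.branches h p v) : h ∉ T.ends p a := by
  rcases ha with ⟨c, ⟨hc, -⟩, rfl⟩ | ⟨i, ⟨hi, -⟩, rfl⟩
  · exact fun h1 => hc (H.eq_root_of_anc_root h1)
  · exact fun h1 => hi (Set.mem_singleton_iff.1 h1).symm

theorem below_mono {u v : T.V} (huv : Anc p v u) : T.below p u ⊆ T.below p v :=
  fun _ hi => huv.trans hi

theorem ends_subset {v : T.V} {a : T.V ⊕ Fin n} (ha : a ∈ T.branches h p v) :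
    T.ends p a ⊆ T.below p v := by
  rcases ha with ⟨c, ⟨-, rfl⟩, rfl⟩ | ⟨i, ⟨-, rfl⟩, rfl⟩
  · exact below_mono (anc_parent p c)
  · rintro _ rfl
    exact Anc.refl _ _

theorem disjoint_ends (H : RootedBy T.graph (T.mark h) p) {v : T.V} {a b : T.V ⊕ Fin n}
    (ha : a ∈ T.branches h p v) (hb : b ∈ T.branches h p v) (hab : a ≠ b) :
    Disjoint (T.ends p a) (T.ends p b) := by
  rw [Set.disjoint_left]
  rcases ha with ⟨c, ⟨hc, rfl⟩, rfl⟩ | ⟨i, ⟨-, rfl⟩, rfl⟩ <;>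
    rcases hb with ⟨c', ⟨hc', hcc⟩, rfl⟩ | ⟨j, ⟨-, hj⟩, rfl⟩
  · have hne : c ≠ c' := fun h1 => hab (by rw [h1])
    intro k h1 h2
    rcases Anc.total h1 h2 with h3 | h3
    · have := h3.eq_or_anc_parent.resolve_left hne
      rw [hcc] at this
      exact H.not_anc_parent hc this
    · have := h3.eq_or_anc_parent.resolve_left hne.symm
      rw [← hcc] at this
      exact H.not_anc_parent hc' this
  · rintro k h1 rfl
    have h1 : Anc p c (T.mark k) := h1
    rw [hj] at h1
    exact H.not_anc_parent hc h1
  · rintro k rfl h2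
    have h2 : Anc p c' (T.mark k) := h2
    rw [← hcc] at h2
    exact H.not_anc_parent hc' h2
  · rintro k rfl h2
    exact hab (congrArg Sum.inr h2)

theorem exists_mem_branches (H : RootedBy T.graph (T.mark h) p) {v : T.V} {i : Fin n}
    (hi : i ∈ T.below p v) (hih : i ≠ h) : ∃ a ∈ T.branches h p v, i ∈ T.ends p a := by
  by_cases hv : T.mark i = v
  · exact ⟨Sum.inr i, Or.inr ⟨i, ⟨hih, hv⟩, rfl⟩, rfl⟩
  · obtain ⟨c, hc, hcv, hci⟩ := H.exists_child hi (Ne.symm hv)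
    exact ⟨Sum.inl c, Or.inl ⟨c, ⟨hc, hcv⟩, rfl⟩, hci⟩

theorem below_nonempty (H : RootedBy T.graph (T.mark h) p) (v : T.V) : (T.below p v).Nonempty := by
  obtain ⟨d, hd⟩ := H.depth
  by_contra hv
  obtain ⟨u, hu, hmax⟩ := Set.exists_max_image {v | ¬ (T.below p v).Nonempty} d (Set.toFinite _)
    ⟨v, hv⟩
  obtain ⟨a, ha⟩ : (T.branches h p u).Nonempty := by
    rw [← Set.ncard_pos]
    have := two_le_branches H u
    omega
  have hsub := ends_subset ha
  rcases ha with ⟨c, ⟨hc, rfl⟩, rfl⟩ | ⟨i, ⟨-, rfl⟩, rfl⟩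
  · exact absurd (hmax c fun h1 => hu (h1.mono hsub)) (not_le.2 (hd c hc))
  · exact hu ⟨i, hsub rfl⟩

theorem ends_nonempty (H : RootedBy T.graph (T.mark h) p) (a : T.V ⊕ Fin n) :
    (T.ends p a).Nonempty := by
  rcases a with c | i
  · exact below_nonempty H c
  · exact Set.singleton_nonempty i

theorem exists_ne_branch (H : RootedBy T.graph (T.mark h) p) {v : T.V} (a : T.V ⊕ Fin n) :
    ∃ b ∈ T.branches h p v, b ≠ a := by
  have := two_le_branches H v
  exact Set.exists_ne_of_one_lt_ncard (by omega) a

/-- The third edge or end at the parent of `v` provides an end that is not below `v`. -/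
theorem exists_notMem_below (H : RootedBy T.graph (T.mark h) p) {v : T.V} (hv : v ≠ T.mark h) :
    ∃ i ∈ T.below p (p v), i ∉ T.below p v ∧ i ≠ h := by
  obtain ⟨b, hb, hne⟩ := exists_ne_branch H (v := p v) (Sum.inl v)
  obtain ⟨i, hi⟩ := ends_nonempty H b
  refine ⟨i, ends_subset hb hi, fun h1 => ?_, ?_⟩
  · exact Set.disjoint_left.1 (disjoint_ends H hb (Or.inl ⟨v, ⟨hv, rfl⟩, rfl⟩) hne) hi h1
  · rintro rfl
    exact notMem_ends H hb hi

theorem below_nontrivial (H : RootedBy T.graph (T.mark h) p) (v : T.V) :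
    (T.below p v).Nontrivial := by
  obtain ⟨a, ha, -⟩ := exists_ne_branch H (v := v) (Sum.inr h)
  obtain ⟨b, hb, hne⟩ := exists_ne_branch H (v := v) a
  obtain ⟨i, hi⟩ := ends_nonempty H a
  obtain ⟨j, hj⟩ := ends_nonempty H b
  refine ⟨i, ends_subset ha hi, j, ends_subset hb hj, ?_⟩
  rintro rfl
  exact Set.disjoint_left.1 (disjoint_ends H hb ha hne) hj hi

theorem below_eq_below_iff (H : RootedBy T.graph (T.mark h) p) {u v : T.V} :
    T.below p u = T.below p v ↔ u = v := by
  refine ⟨fun huv => ?_, fun huv => huv ▸ rfl⟩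
  have key : ∀ u v, T.below p u = T.below p v → Anc p v u → u = v := by
    intro u v huv hvu
    by_contra hne
    have hur : u ≠ T.mark h := by
      rintro rfl
      exact hne (H.eq_root_of_anc_root hvu).symm
    obtain ⟨i, hi, hiu, -⟩ := exists_notMem_below H hur
    have := below_mono (T := T) (hvu.eq_or_anc_parent.resolve_left (Ne.symm hne)) hi
    rw [← huv] at this
    exact hiu this
  obtain ⟨i, hi⟩ := below_nonempty H u
  have hi' := hi
  rw [huv] at hi'
  rcases Anc.total hi hi' with h1 | h1
  · exact (key v u huv.symm h1).symm
  · exact key u v huv h1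

theorem below_subset_below_iff (H : RootedBy T.graph (T.mark h) p) {u v : T.V} :
    T.below p u ⊆ T.below p v ↔ Anc p v u := by
  refine ⟨fun huv => ?_, below_mono⟩
  obtain ⟨i, hi⟩ := below_nonempty H u
  rcases Anc.total hi (huv hi) with h1 | h1
  · rw [(below_eq_below_iff H).1 (huv.antisymm (below_mono h1))]
    exact Anc.refl _ _
  · exact h1

theorem below_root (H : RootedBy T.graph (T.mark h) p) : T.below p (T.mark h) = Set.univ :=
  Set.eq_univ_of_forall fun _ => H.root_anc _

theorem mem_below_iff_eq_root (H : RootedBy T.graph (T.mark h) p) {v : T.V} :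
    h ∈ T.below p v ↔ v = T.mark h :=
  ⟨fun h1 => H.eq_root_of_anc_root h1, fun h1 => h1 ▸ Anc.refl _ _⟩

theorem side_parent (H : RootedBy T.graph (T.mark h) p) (v : T.V) :
    T.side (p v) v = T.below p v := by
  ext i
  rw [side, Set.mem_ofPred_eq, Sym2.eq_swap, H.reachable_self_iff]
  rfl

theorem side_of_parent (H : RootedBy T.graph (T.mark h) p) {v : T.V} (hv : v ≠ T.mark h) :
    T.side v (p v) = (T.below p v)ᶜ := by
  ext i
  rw [side, Set.mem_ofPred_eq, H.reachable_parent_iff hv]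
  rfl

theorem mem_clades_iff (H : RootedBy T.graph (T.mark h) p) {I : Set (Fin n)} :
    I ∈ T.clades h ↔ ∃ v, v ≠ T.mark h ∧ T.below p v = I := by
  constructor
  · rintro ⟨hI, u, v, huv, rfl⟩
    rcases (H.adj_iff u v).1 huv with ⟨h1, rfl⟩ | ⟨h1, rfl⟩
    · rw [side_of_parent H h1] at hI
      exact absurd (fun h2 => h1 ((mem_below_iff_eq_root H).1 h2)) hI
    · exact ⟨v, h1, (side_parent H v).symm⟩
  · rintro ⟨v, hv, rfl⟩
    exact ⟨fun h1 => hv ((mem_below_iff_eq_root H).1 h1), p v, v, (H.adj_parent hv).symm,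
      (side_parent H v).symm⟩

end Rooted

theorem exists_rootedBy (T : CombType n) (h : Fin n) : ∃ p, RootedBy T.graph (T.mark h) p :=
  T.isTree.exists_rootedBy _

theorem isCladeFamily_clades (T : CombType n) (h : Fin n) : IsCladeFamily h (T.clades h) := by
  obtain ⟨p, H⟩ := T.exists_rootedBy h
  refine ⟨?_, fun I hI => hI.1, ?_, ?_⟩
  · intro I hI J hJ
    obtain ⟨u, -, rfl⟩ := (mem_clades_iff H).1 hI
    obtain ⟨v, -, rfl⟩ := (mem_clades_iff H).1 hJ
    by_cases hd : Disjoint (T.below p u) (T.below p v)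
    · exact Or.inr (Or.inr hd)
    · rw [Set.not_disjoint_iff] at hd
      obtain ⟨i, hi, hj⟩ := hd
      rcases Anc.total hi hj with h1 | h1
      · exact Or.inr (Or.inl (below_mono h1))
      · exact Or.inl (below_mono h1)
  · intro I hI
    obtain ⟨u, -, rfl⟩ := (mem_clades_iff H).1 hI
    exact below_nontrivial H u
  · intro I hI hI'
    obtain ⟨u, hu, rfl⟩ := (mem_clades_iff H).1 hI
    obtain ⟨i, -, hi, hih⟩ := exists_notMem_below H hu
    rw [hI'] at hi
    exact hi hih

/-- A combinatorial type is top-dimensional if and only if it is trivalent. -/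
theorem isTop_iff {T : CombType n} {h : Fin n} {p : T.V → T.V}
    (H : RootedBy T.graph (T.mark h) p) :
    T.IsTop ↔ ∀ v, (T.branches h p v).ncard = 2 := by
  classical
  have hE : T.graph.edgeSet.ncard + 1 = Fintype.card T.V := by
    rw [← T.isTree.card_edgeFinset, Set.ncard_eq_toFinset_card', SimpleGraph.edgeFinset]
  have hdeg : ∑ v, (T.graph.neighborSet v).ncard = 2 * T.graph.edgeSet.ncard := by
    have h1 := T.graph.sum_degrees_eq_twice_card_edges
    rw [SimpleGraph.edgeFinset, ← Set.ncard_eq_toFinset_card'] at h1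
    rw [← h1]
    refine Finset.sum_congr rfl fun v _ => ?_
    rw [Set.ncard_eq_toFinset_card', ← SimpleGraph.card_neighborFinset_eq_degree,
      SimpleGraph.neighborFinset]
  have hmark : ∑ v, {i | T.mark i = v}.ncard = n := by
    have h1 := Finset.card_eq_sum_card_fiberwise (f := T.mark) (s := Finset.univ)
      (t := Finset.univ) (fun _ _ => Finset.mem_coe.2 (Finset.mem_univ _))
    rw [Finset.card_univ, Fintype.card_fin] at h1
    conv_rhs => rw [h1]
    refine Finset.sum_congr rfl fun v _ => ?_
    rw [Set.ncard_eq_toFinset_card']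
    congr 1
    ext i
    simp
  have hsum : ∑ v, (T.branches h p v).ncard + Fintype.card T.V =
      2 * T.graph.edgeSet.ncard + n := by
    have h1 := Finset.sum_congr (rfl : (Finset.univ : Finset T.V) = _) fun v _ => valence_eq H v
    rw [Finset.sum_add_distrib, Finset.sum_add_distrib, hdeg, hmark] at h1
    rw [h1]
    simp
  have htwo : ∑ _v : T.V, 2 = 2 * Fintype.card T.V := by simp [mul_comm]
  have hle : ∀ v ∈ (Finset.univ : Finset T.V), 2 ≤ (T.branches h p v).ncard :=
    fun v _ => two_le_branches H v
  have h3 : T.IsTop ↔ ∑ _v : T.V, 2 = ∑ v, (T.branches h p v).ncard := by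
    rw [IsTop, htwo]
    omega
  rw [h3, Finset.sum_eq_sum_iff_of_le hle]
  simp [eq_comm]

/-- A combinatorial type is determined by its clades: the vertices of the tree correspond to the
clades and the set of all ends, the edges to the covering relation, and an end is attached to the
smallest set that contains it. -/
theorem iso_of_clades_eq {T T' : CombType n} (h : Fin n) (hc : T.clades h = T'.clades h) :
    T.Iso T' := by
  obtain ⟨p, H⟩ := T.exists_rootedBy h
  obtain ⟨p', H'⟩ := T'.exists_rootedBy h
  have key : ∀ (T T' : CombType n) (p p'), RootedBy T.graph (T.mark h) p →
      RootedBy T'.graph (T'.mark h) p' → T.clades h = T'.clades h →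
      ∀ v, ∃ v', T'.below p' v' = T.below p v := by
    intro T T' p p' H H' hc v
    by_cases hv : v = T.mark h
    · exact ⟨T'.mark h, by rw [hv, below_root H, below_root H']⟩
    · have := (mem_clades_iff H).2 ⟨v, hv, rfl⟩
      rw [hc] at this
      obtain ⟨v', -, hv'⟩ := (mem_clades_iff H').1 this
      exact ⟨v', hv'⟩
  choose f hf using key T T' p p' H H' hc
  choose g hg using key T' T p' p H' H hc.symm
  have hgf : ∀ v, g (f v) = v := fun v => (below_eq_below_iff H).1 (by rw [hg, hf])
  have hfg : ∀ v, f (g v) = v := fun v => (below_eq_below_iff H').1 (by rw [hf, hg])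
  have hanc : ∀ u v, Anc p' (f u) (f v) ↔ Anc p u v := by
    intro u v
    rw [← below_subset_below_iff H, ← below_subset_below_iff H', hf, hf]
  have hroot : f (T.mark h) = T'.mark h :=
    (below_eq_below_iff H').1 (by rw [hf, below_root H, below_root H'])
  have hpar : ∀ v, f (p v) = p' (f v) := by
    intro v
    by_cases hv : v = T.mark h
    · rw [hv, H.root, hroot, H'.root]
    have hv' : f v ≠ T'.mark h := by
      intro h1
      rw [← hroot] at h1
      apply hv
      rw [← hgf v, h1, hgf]
    apply H'.anc_antisymm
    · have h1 := ((hanc (p v) v).2 (anc_parent p v)).eq_or_anc_parent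
      refine h1.resolve_left fun h2 => (H.adj_parent hv).ne ?_
      have h3 := congrArg g h2
      rw [hgf, hgf] at h3
      exact h3.symm
    · have h1 : Anc p (g (p' (f v))) v := by
        rw [← hanc, hfg]
        exact anc_parent _ _
      rw [← hfg (p' (f v)), hanc]
      refine h1.eq_or_anc_parent.resolve_left fun h2 => (H'.adj_parent hv').ne ?_
      rw [← hfg (p' (f v)), h2]
  refine ⟨⟨⟨f, g, hgf, hfg⟩, ?_⟩, ?_⟩
  · intro a b
    have hinj : ∀ u v, f u = f v ↔ u = v :=
      fun u v => ⟨fun h1 => by rw [← hgf u, h1, hgf], fun h1 => by rw [h1]⟩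
    change T'.graph.Adj (f a) (f b) ↔ T.graph.Adj a b
    rw [H.adj_iff, H'.adj_iff, ← hpar, ← hpar, ← hroot, hinj, hinj, Ne, Ne, hinj, hinj]
  · intro i
    apply H'.anc_antisymm
    · have h1 : i ∈ T.below p (T.mark i) := Anc.refl _ _
      rw [← hf] at h1
      exact h1
    · have h1 : i ∈ T'.below p' (T'.mark i) := Anc.refl _ _
      rw [← hg] at h1
      have h2 := (hanc _ _).2 h1
      rwa [hfg] at h2

end CombType

/-! ### Combinatorial types and curves with given clades -/

namespace CombType

variable {n : ℕ}

/-- Every laminar family of suitable sets is the family of clades of a combinatorial type: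
the vertices are the members of the family and the set of all ends, and each set is joined to the
smallest set that properly contains it. -/
theorem exists_clades_eq (hn : 3 ≤ n) {h : Fin n} {𝓕 : Set (Set (Fin n))}
    (h𝓕 : IsCladeFamily h 𝓕) : ∃ T : CombType n, T.clades h = 𝓕 := by
  classical
  let V := {I : Set (Fin n) // I ∈ 𝓕 ∨ I = Set.univ}
  let r : V := ⟨Set.univ, Or.inr rfl⟩
  have hmem : ∀ {I : V}, h ∈ I.1 ↔ I = r := by
    intro I
    constructor
    · intro hI
      exact Subtype.ext (I.2.resolve_left fun h1 => h𝓕.notMem _ h1 hI)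
    · rintro rfl
      exact Set.mem_univ _
  have hnt : ∀ I : V, (I.1 \ {h}).Nontrivial := by
    rintro ⟨I, hI | rfl⟩
    · rw [Set.sdiff_singleton_eq_self (h𝓕.notMem _ hI)]
      exact h𝓕.nontrivial _ hI
    · rw [← Set.one_lt_ncard_iff_nontrivial, Set.ncard_sdiff_singleton_of_mem (Set.mem_univ _),
        Set.ncard_univ, Nat.card_fin]
      omega
  have hcomp : ∀ {I J : V} {i : Fin n}, i ∈ I.1 → i ∈ J.1 → I.1 ⊆ J.1 ∨ J.1 ⊆ I.1 := by
    rintro ⟨I, hI | rfl⟩ ⟨J, hJ | rfl⟩ i hi hj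
    · rcases h𝓕.laminar I hI J hJ with h1 | h1 | h1
      · exact Or.inl h1
      · exact Or.inr h1
      · exact absurd hj (Set.disjoint_left.1 h1 hi)
    all_goals simp
  -- A set in a laminar family that is minimal among those with a common element is the smallest.
  have hmin : ∀ (P : V → Prop) (i : Fin n), P r → (∀ I, P I → i ∈ I.1) →
      ∃ I, P I ∧ ∀ J, P J → I.1 ⊆ J.1 := by
    intro P i hr hi
    obtain ⟨I, hI, hle⟩ := Set.exists_min_image {I : V | P I} (fun I => I.1.ncard)
      (Set.toFinite _) ⟨r, hr⟩
    refine ⟨I, hI, fun J hJ => ?_⟩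
    rcases hcomp (hi I hI) (hi J hJ) with h1 | h1
    · exact h1
    · exact (Set.eq_of_subset_of_ncard_le h1 (hle J hJ)).symm.subset
  have hpar : ∀ I : V, ∃ J : V, (I = r → J = r) ∧
      (I ≠ r → I.1 ⊂ J.1 ∧ ∀ K : V, I.1 ⊂ K.1 → J.1 ⊆ K.1) := by
    intro I
    by_cases hI : I = r
    · exact ⟨r, fun _ => rfl, fun h1 => absurd hI h1⟩
    · obtain ⟨i, hi⟩ := (hnt I).nonempty
      obtain ⟨J, hJ⟩ := hmin (fun J => I.1 ⊂ J.1) i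
        ((Set.subset_univ _).ssubset_of_ne fun h1 => hI (Subtype.ext h1)) (fun J hJ => hJ.1 hi.1)
      exact ⟨J, fun h1 => absurd h1 hI, fun _ => hJ⟩
  choose p hpr hp using hpar
  have hmark : ∀ i, ∃ I : V, i ∈ I.1 ∧ ∀ J : V, i ∈ J.1 → I.1 ⊆ J.1 := fun i =>
    hmin (fun J => i ∈ J.1) i (Set.mem_univ _) (fun J hJ => hJ)
  choose mark hmark hmark' using hmark
  have hmarkh : mark h = r := hmem.1 (hmark h)
  let G : SimpleGraph V :=
    { Adj := fun a b => (a ≠ r ∧ p a = b) ∨ (b ≠ r ∧ p b = a)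
      symm := ⟨fun a b => Or.symm⟩
      loopless := ⟨fun a ha => by
        have h1 : a ≠ r ∧ p a = a := ha.elim id id
        have h2 := (hp a h1.1).1
        rw [h1.2] at h2
        exact h2.ne rfl⟩ }
  have H : RootedBy G r p := by
    refine ⟨hpr r rfl, fun a b => Iff.rfl, fun I => (I.1ᶜ).ncard, fun I hI => ?_⟩
    exact Set.ncard_lt_ncard (compl_lt_compl_iff_lt.2 (hp I hI).1)
  have hsub : ∀ I, I.1 ⊆ (p I).1 := by
    intro I
    by_cases hI : I = r
    · rw [hpr I hI]; exact Set.subset_univ _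
    · exact (hp I hI).1.subset
  have hanc : ∀ J I, Anc p J I ↔ I.1 ⊆ J.1 := by
    intro J I
    constructor
    · rintro ⟨k, rfl⟩
      induction k with
      | zero => exact subset_rfl
      | succ k ih =>
        rw [Function.iterate_succ_apply']
        exact ih.trans (hsub _)
    · intro hIJ
      induction hk : (I.1ᶜ).ncard using Nat.strong_induction_on generalizing I with
      | _ k ih =>
        by_cases hne : I = J
        · subst hne; exact Anc.refl _ _
        · have h1 : I.1 ⊂ J.1 := hIJ.ssubset_of_ne fun h1 => hne (Subtype.ext h1)
          have hI : I ≠ r := by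
            rintro rfl
            exact h1.2 (Set.subset_univ _)
          refine (ih _ ?_ (p I) ((hp I hI).2 J h1) rfl).trans (anc_parent p I)
          rw [← hk]
          exact Set.ncard_lt_ncard (compl_lt_compl_iff_lt.2 (hp I hI).1)
  have hval : ∀ I : V, 3 ≤ (G.neighborSet I).ncard + {i | mark i = I}.ncard := by
    intro I
    set X : Set (V ⊕ Fin n) := Sum.inl '' G.neighborSet I ∪ Sum.inr '' {i | mark i = I} with hX
    have h1 : X.ncard = (G.neighborSet I).ncard + {i | mark i = I}.ncard := by
      rw [hX, Set.ncard_union_eq, Set.ncard_image_of_injective _ Sum.inl_injective,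
        Set.ncard_image_of_injective _ Sum.inr_injective]
      rw [Set.disjoint_left]
      rintro _ ⟨a, -, rfl⟩ ⟨b, -, hb⟩
      cases hb
    rw [← h1]
    let s : V ⊕ Fin n → Set (Fin n) := Sum.elim (fun J => J.1) fun i => {i}
    obtain ⟨z, hz, hzX⟩ : ∃ z, z ∈ X ∧ ∀ x ∈ X, x ≠ Sum.inr h → (∀ c : V, x = Sum.inl c → c ≠ r ∧
        p c = I) → x ≠ z := by
      by_cases hI : I = r
      · exact ⟨Sum.inr h, Or.inr ⟨h, hmarkh.trans hI.symm, rfl⟩, fun x _ hx _ => hx⟩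
      · refine ⟨Sum.inl (p I), Or.inl ⟨p I, Or.inl ⟨hI, rfl⟩, rfl⟩, ?_⟩
        rintro x _ _ h3 rfl
        have h4 := (hp I hI).1
        have h5 := hsub (p I)
        rw [(h3 _ rfl).2] at h5
        exact h4.2 h5
    have key : ∀ i ∈ I.1, i ≠ h → ∃ x ∈ X, x ≠ z ∧ i ∈ s x ∧ ∃ j ∈ I.1, j ≠ h ∧ j ∉ s x := by
      intro i hi hih
      by_cases hmi : mark i = I
      · refine ⟨Sum.inr i, Or.inr ⟨i, hmi, rfl⟩, ?_, rfl, ?_⟩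
        · exact hzX _ (Or.inr ⟨i, hmi, rfl⟩) (fun h2 => hih (Sum.inr_injective h2))
            (fun c hc => by cases hc)
        · obtain ⟨j, hj, hji⟩ := (hnt I).exists_ne i
          exact ⟨j, hj.1, hj.2, hji⟩
      · obtain ⟨c, hcr, rfl, hci⟩ := H.exists_child ((hanc I (mark i)).2 (hmark' i I hi))
          (Ne.symm hmi)
        have hcX : Sum.inl c ∈ X := Or.inl ⟨c, Or.inr ⟨hcr, rfl⟩, rfl⟩
        refine ⟨Sum.inl c, hcX, hzX _ hcX (by simp) ?_, (hanc _ _).1 hci (hmark i), ?_⟩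
        · rintro _ ⟨⟩
          exact ⟨hcr, rfl⟩
        · by_contra hcon
          push Not at hcon
          have hch : h ∉ c.1 := fun h2 => hcr (hmem.1 h2)
          by_cases hI : p c = r
          · refine h𝓕.ne_compl c.1 (c.2.resolve_right fun h2 => hcr (Subtype.ext h2)) ?_
            refine Set.Subset.antisymm (fun j hj => ?_) (fun j hj => hcon j ?_ hj)
            · rintro rfl
              exact hch hj
            · rw [hI]; exact Set.mem_univ _
          · refine (hp c hcr).1.2 fun j hj => hcon j hj ?_
            rintro rfl
            exact hI (hmem.1 hj)
    obtain ⟨i, hi⟩ := (hnt I).nonempty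
    obtain ⟨x, hx, hxz, hix, j, hj, hjh, hjx⟩ := key i hi.1 hi.2
    obtain ⟨y, hy, hyz, hjy, -⟩ := key j hj hjh
    refine Nat.succ_le_of_lt ((Set.two_lt_ncard_iff (Set.toFinite _)).2
      ⟨x, y, z, hx, hy, hz, ?_, hxz, hyz⟩)
    rintro rfl
    exact hjx hjy
  have H' : RootedBy G (mark h) p := by rwa [hmarkh]
  refine ⟨⟨V, inferInstance, G, H.isTree, mark, hval⟩, ?_⟩
  ext I
  rw [mem_clades_iff H']
  have hbelow : ∀ J : V, {i | Anc p J (mark i)} = J.1 := by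
    intro J
    ext i
    change Anc p J (mark i) ↔ i ∈ J.1
    rw [hanc]
    exact ⟨fun h1 => h1 (hmark i), hmark' i J⟩
  constructor
  · rintro ⟨J, hJ, rfl⟩
    change {i | Anc p J (mark i)} ∈ 𝓕
    rw [hbelow]
    refine J.2.resolve_right fun h1 => hJ ?_
    change J = mark h
    rw [hmarkh]
    exact Subtype.ext h1
  · intro hI
    refine ⟨⟨I, Or.inl hI⟩, ?_, hbelow _⟩
    change _ ≠ mark h
    rw [hmarkh]
    intro h1
    have h2 := hmem.2 h1
    exact h𝓕.notMem I hI h2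

end CombType

section Splits

variable {n : ℕ}

theorem splitVec_compl (I : Set (Fin n)) : splitVec Iᶜ = splitVec I := by
  unfold splitVec
  congr 1
  ext ⟨e, he⟩
  induction e using Sym2.ind with
  | _ i j => 
    by_cases hi : i ∈ I <;> by_cases hj : j ∈ I <;> simp [pairVec, hi, hj]

theorem CombType.cone_eq (T : CombType n) (h : Fin n) :
    T.cone = PointedCone.hull ℝ (splitVec '' T.clades h) := by
  obtain ⟨p, H⟩ := T.exists_rootedBy h
  unfold CombType.cone
  congr 1
  ext x
  constructor
  · rintro ⟨u, v, huv, rfl⟩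
    rcases (H.adj_iff u v).1 huv with ⟨h1, rfl⟩ | ⟨h1, rfl⟩
    · exact ⟨T.below p u, (mem_clades_iff H).2 ⟨u, h1, rfl⟩, by
        rw [side_of_parent H h1, splitVec_compl]⟩
    · exact ⟨T.below p v, (mem_clades_iff H).2 ⟨v, h1, rfl⟩, by rw [side_parent H]⟩
  · rintro ⟨I, hI, rfl⟩
    obtain ⟨-, u, v, huv, rfl⟩ := hI
    exact ⟨u, v, huv, rfl⟩

open Classical in
theorem TropicalCurve.distVec_eq_sum (C : TropicalCurve n) {h : Fin n} {p : C.V → C.V}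
    (H : RootedBy C.graph (C.mark h) p) :
    C.distVec = ∑ v, (if v ≠ C.mark h then C.length s(v, p v) else 0) •
      splitVec (C.toCombType.below p v) := by
  unfold TropicalCurve.distVec splitVec
  refine (congrArg _ ?_).trans (map_sum (LinearMap.range (leafShift n)).mkQ (fun v =>
    (if v ≠ C.mark h then C.length s(v, p v) else 0) • pairVec (fun i j =>
      if (i ∈ C.toCombType.below p v ↔ j ∈ C.toCombType.below p v) then 0 else 1)
      fun i j => by simp only [iff_comm]) Finset.univ)
  ext ⟨e, he⟩
  induction e using Sym2.ind with
  | _ i j =>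
    simp only [pairVec, Sym2.lift_mk, Finset.sum_apply, Pi.smul_apply, smul_eq_mul]
    unfold TropicalCurve.dist
    rw [H.sum_edges_eq C.length _ (C.isTree.existsUnique_path _ _).choose_spec.1]
    refine Finset.sum_congr rfl fun v _ => ?_
    by_cases hv : v = C.mark h
    · simp [hv]
    · simp only [CombType.below, Set.mem_ofPred_eq, hv, ne_eq, not_false_iff, true_and]
      split_ifs <;> simp_all

open Classical in
/-- The sum over the vertices other than the root as a sum over all sets of ends. -/
theorem CombType.sum_vertices_eq {M : Type*} [AddCommMonoid M] {T : CombType n} {h : Fin n}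
    {p : T.V → T.V} (H : RootedBy T.graph (T.mark h) p) (f : Set (Fin n) → M)
    (hf : ∀ I, I ∉ T.clades h → f I = 0) :
    ∑ I, f I = ∑ v ∈ Finset.univ.filter (· ≠ T.mark h), f (T.below p v) := by
  rw [← Finset.sum_image (f := f) (g := T.below p)
    (fun u _ v _ huv => (below_eq_below_iff H).1 huv)]
  symm
  refine Finset.sum_subset (Finset.subset_univ _) fun I _ hI => hf I fun h1 => hI ?_
  obtain ⟨v, hv, rfl⟩ := (mem_clades_iff H).1 h1
  exact Finset.mem_image_of_mem _ (Finset.mem_filter.2 ⟨Finset.mem_univ _, hv⟩)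

theorem TropicalCurve.exists_distVec_eq (C : TropicalCurve n) (h : Fin n) :
    ∃ c : Set (Fin n) → ℝ, (∀ I, 0 ≤ c I) ∧ (∀ I, I ∉ C.toCombType.clades h → c I = 0) ∧
      C.distVec = ∑ I, c I • splitVec I := by
  classical
  obtain ⟨p, H⟩ := C.toCombType.exists_rootedBy h
  have hinj : ∀ u v, C.toCombType.below p u = C.toCombType.below p v → u = v :=
    fun u v => (CombType.below_eq_below_iff H).1
  let c : Set (Fin n) → ℝ := fun I =>
    if hI : ∃ v, v ≠ C.mark h ∧ C.toCombType.below p v = I then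
      C.length s(hI.choose, p hI.choose) else 0
  have hc0 : ∀ I, I ∉ C.toCombType.clades h → c I = 0 := fun I hI =>
    dif_neg fun h1 => hI ((CombType.mem_clades_iff H).2 h1)
  refine ⟨c, fun I => ?_, hc0, ?_⟩
  · by_cases hI : ∃ v, v ≠ C.mark h ∧ C.toCombType.below p v = I
    · simp only [c, dif_pos hI]
      exact (C.length_pos _ (H.adj_parent hI.choose_spec.1)).le
    · simp [c, dif_neg hI]
  · rw [CombType.sum_vertices_eq H _ fun I hI => by rw [hc0 I hI, zero_smul],
      C.distVec_eq_sum H, Finset.sum_filter]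
    refine Finset.sum_congr rfl fun v _ => ?_
    by_cases hv : v = C.mark h
    · simp [hv]
    · have hI : ∃ u, u ≠ C.mark h ∧ C.toCombType.below p u = C.toCombType.below p v :=
        ⟨v, hv, rfl⟩
      rw [if_pos hv, if_pos hv]
      simp only [c, dif_pos hI]
      rw [hinj _ _ hI.choose_spec.2]

theorem exists_tropicalCurve (hn : 3 ≤ n) {h : Fin n} {𝓕 : Set (Set (Fin n))}
    (h𝓕 : IsCladeFamily h 𝓕) (c : Set (Fin n) → ℝ) (hpos : ∀ I ∈ 𝓕, 0 < c I)
    (hzero : ∀ I, I ∉ 𝓕 → c I = 0) :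
    ∃ C : TropicalCurve n, C.distVec = ∑ I, c I • splitVec I := by
  classical
  obtain ⟨T, rfl⟩ := CombType.exists_clades_eq hn h𝓕
  obtain ⟨p, H⟩ := T.exists_rootedBy h
  -- The clade of an edge is the intersection of the sets of descendants of its endpoints.
  have hinter : ∀ v, T.below p v ∩ T.below p (p v) = T.below p v := fun v =>
    Set.inter_eq_left.2 (CombType.below_mono (anc_parent p v))
  let C : TropicalCurve n :=
    { T with
      length := Sym2.lift ⟨fun u v => c (T.below p u ∩ T.below p v), fun u v => by
        simp only [Set.inter_comm]⟩
      length_pos := by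
        intro e he
        induction e using Sym2.ind with
        | _ u v =>
          rcases (H.adj_iff u v).1 he with ⟨h1, rfl⟩ | ⟨h1, rfl⟩
          · rw [Sym2.lift_mk]
            simp only [hinter]
            exact hpos _ ((CombType.mem_clades_iff H).2 ⟨_, h1, rfl⟩)
          · rw [Sym2.lift_mk]
            simp only [Set.inter_comm (T.below p (p v)), hinter]
            exact hpos _ ((CombType.mem_clades_iff H).2 ⟨_, h1, rfl⟩) }
  refine ⟨C, ?_⟩
  rw [C.distVec_eq_sum (h := h) (p := p) H, CombType.sum_vertices_eq H _ fun I hI => by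
    rw [hzero I hI, zero_smul], Finset.sum_filter]
  refine Finset.sum_congr rfl fun v _ => ?_
  by_cases hv : v = T.mark h
  · have hv' : ¬ v ≠ C.mark h := not_not.2 hv
    rw [if_neg (not_not.2 hv), if_neg hv', zero_smul]
  · have hv' : v ≠ C.mark h := hv
    have hlen : C.length s(v, p v) = c (T.below p v ∩ T.below p (p v)) := rfl
    rw [if_pos hv, if_pos hv', hlen, hinter]

end Splits

/-! ### Cycle matroids and Bergman fans -/

theorem mem_closure_cycleMatroid_iff_of_indep {V : Type*} [Finite V] {G : SimpleGraph V}
    {I : Set (Sym2 V)} (hI : (cycleMatroid G).Indep I) {u v : V} (huv : G.Adj u v) :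
    s(u, v) ∈ (cycleMatroid G).closure I ↔ (SimpleGraph.fromEdgeSet I).Reachable u v := by
  have hI' : I ⊆ G.edgeSet ∧ (SimpleGraph.fromEdgeSet I).IsAcyclic := hI
  by_cases he : s(u, v) ∈ I
  · exact iff_of_true ((cycleMatroid G).mem_closure_of_mem' he (hI'.1 he))
      (SimpleGraph.Adj.reachable (by
        rw [SimpleGraph.fromEdgeSet_adj]; exact ⟨he, huv.ne⟩))
  · have huvE : s(u, v) ∈ (cycleMatroid G).E := huv
    rw [← not_iff_not, hI.notMem_closure_iff huvE, and_iff_left he]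
    constructor
    · intro h1 hr
      have h2 := (SimpleGraph.isAcyclic_iff_forall_isBridge.mp h1.2) (e := s(u, v))
        (by simp [huv.ne])
      rw [SimpleGraph.isBridge_iff, SimpleGraph.deleteEdges_fromEdgeSet,
        Set.insert_sdiff_self_of_notMem he] at h2
      exact h2 hr
    · intro hr
      refine ⟨Set.insert_subset huv hI'.1, (hI'.2.sup_edge_of_not_reachable hr).anti ?_⟩
      rw [Set.insert_eq, SimpleGraph.fromEdgeSet_union, sup_comm]
      exact le_rfl

/-- An edge is in the closure of a set `X` of edges if and only if its endpoints are connected by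
edges in `X`. -/
theorem mem_closure_cycleMatroid_iff {V : Type*} [Finite V] {G : SimpleGraph V}
    {X : Set (Sym2 V)} (hX : X ⊆ G.edgeSet) {u v : V} (huv : G.Adj u v) :
    s(u, v) ∈ (cycleMatroid G).closure X ↔ (SimpleGraph.fromEdgeSet X).Reachable u v := by
  obtain ⟨I, hI⟩ := (cycleMatroid G).exists_isBasis X hX
  rw [← hI.closure_eq_closure, mem_closure_cycleMatroid_iff_of_indep hI.indep huv]
  refine ⟨fun h1 => h1.mono (SimpleGraph.fromEdgeSet_mono hI.subset), ?_⟩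
  rintro ⟨q⟩
  clear huv
  induction q with
  | nil => exact SimpleGraph.Reachable.refl _
  | cons hab _ ih =>
    rw [SimpleGraph.fromEdgeSet_adj] at hab
    exact ((mem_closure_cycleMatroid_iff_of_indep hI.indep (hX hab.1)).1
      (hI.subset_closure hab.1)).trans ih

theorem isFlat_cycleMatroid_iff {V : Type*} [Finite V] {G : SimpleGraph V} {F : Set (Sym2 V)} :
    (cycleMatroid G).IsFlat F ↔ F ⊆ G.edgeSet ∧ ∀ u v, G.Adj u v →
      (SimpleGraph.fromEdgeSet F).Reachable u v → s(u, v) ∈ F := by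
  constructor
  · intro hF
    refine ⟨hF.subset_ground, fun u v huv hr => ?_⟩
    rw [← hF.closure]
    exact (mem_closure_cycleMatroid_iff hF.subset_ground huv).2 hr
  · rintro ⟨hF, h1⟩
    rw [Matroid.isFlat_iff_closure_eq]
    refine Set.Subset.antisymm (fun e he => ?_) ((cycleMatroid G).subset_closure F hF)
    have heE : e ∈ G.edgeSet := (cycleMatroid G).closure_subset_ground F he
    induction e using Sym2.ind with
    | _ u v => exact h1 u v heE ((mem_closure_cycleMatroid_iff hF heE).1 he)

theorem setWeight_insert {α : Type*} {M : Matroid α} [M.Finite] (x : M.E → ℝ) {B : Set α} {f : α}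
    (hf : f ∈ M.E) (hfB : f ∉ B) :
    setWeight M x (insert f B) = x ⟨f, hf⟩ + setWeight M x B := by
  have : Finite M.E := M.ground_finite
  have h1 : {e : M.E | (e : α) ∈ insert f B} = insert ⟨f, hf⟩ {e : M.E | (e : α) ∈ B} := by
    ext e
    simp [Subtype.ext_iff]
  unfold setWeight
  rw [h1, finsum_mem_insert _ (by simpa using hfB) (Set.toFinite _)]

theorem setWeight_sdiff {α : Type*} {M : Matroid α} [M.Finite] (x : M.E → ℝ) {B : Set α} {f : α}
    (hf : f ∈ M.E) (hfB : f ∈ B) :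
    setWeight M x B = x ⟨f, hf⟩ + setWeight M x (B \ {f}) := by
  rw [← setWeight_insert x hf (fun h1 => h1.2 rfl), Set.insert_sdiff_self_of_mem hfB]

/-- An element lies in a base of minimal weight if and only if it is not spanned by lighter
elements. -/
theorem mem_bergmanFan_iff {α : Type*} {M : Matroid α} [M.Finite] (x : M.E → ℝ) :
    x ∈ bergmanFan M ↔
      ∀ e : M.E, (e : α) ∉ M.closure (Subtype.val '' {f : M.E | x f < x e}) := by
  constructor
  · intro hx e he
    obtain ⟨B, ⟨hB, hmin⟩, heB⟩ := hx e
    have h1 := hB.indep.notMem_closure_sdiff_of_mem heB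
    obtain ⟨f, hf, hfcl⟩ : ∃ f : M.E, x f < x e ∧ (f : α) ∉ M.closure (B \ {(e : α)}) := by
      by_contra hcon
      push Not at hcon
      refine h1 (M.closure_subset_closure_of_subset_closure ?_ he)
      rintro _ ⟨f, hf, rfl⟩
      exact hcon f hf
    have hfB : (f : α) ∉ B \ {(e : α)} := fun h2 =>
      hfcl (M.mem_closure_of_mem' h2 f.2)
    have h2 := hmin _ (hB.exchange_base_of_notMem_closure heB hfcl f.2)
    rw [setWeight_insert x f.2 hfB, setWeight_sdiff x e.2 heB] at h2
    simp only [Subtype.coe_eta] at h2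
    linarith
  · intro hx e
    obtain ⟨B, hB, hmin⟩ := Set.exists_min_image {B | M.IsBase B} (setWeight M x)
      (M.ground_finite.finite_subsets.subset fun B hB => hB.subset_ground) M.exists_isBase
    by_cases heB : (e : α) ∈ B
    · exact ⟨B, ⟨hB, hmin⟩, heB⟩
    · have hB : M.IsBase B := hB
      have hC := hB.fundCircuit_isCircuit e.2 heB
      have hcl := hC.mem_closure_sdiff_singleton_of_mem (M.mem_fundCircuit e B)
      obtain ⟨f, hfC, hfe, hfx⟩ : ∃ f : M.E, (f : α) ∈ M.fundCircuit e B ∧ (f : α) ≠ e ∧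
          x e ≤ x f := by
        by_contra hcon
        push Not at hcon
        refine hx e (M.closure_subset_closure ?_ hcl)
        intro f hf
        exact ⟨⟨f, hC.subset_ground hf.1⟩, hcon ⟨f, hC.subset_ground hf.1⟩ hf.1 hf.2, rfl⟩
      have hfB : (f : α) ∈ B :=
        ((M.fundCircuit_subset_insert e B) hfC).resolve_left hfe
      have h1 := hB.exchange_isBase_of_indep' hfB heB
        ((hB.indep.mem_fundCircuit_iff (by rw [hB.closure_eq]; exact e.2) heB).1 hfC)
      refine ⟨_, ⟨h1, fun B' hB' => le_trans ?_ (hmin B' hB')⟩, ⟨Set.mem_insert _ _, hfe.symm⟩⟩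
      rw [Set.insert_sdiff_of_notMem _ (by simpa using hfe.symm),
        setWeight_insert x e.2 (fun h2 => heB h2.1), setWeight_sdiff x f.2 hfB]
      simpa using hfx

theorem mem_bergmanFan_cycleMatroid_iff {V : Type*} [Finite V] {G : SimpleGraph V}
    (x : (cycleMatroid G).E → ℝ) :
    x ∈ bergmanFan (cycleMatroid G) ↔ ∀ u v (huv : G.Adj u v),
      ¬ (SimpleGraph.fromEdgeSet (Subtype.val '' {f | x f < x ⟨s(u, v), huv⟩})).Reachable u v := by
  have : (cycleMatroid G).Finite := ⟨Set.toFinite _⟩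
  rw [mem_bergmanFan_iff]
  have hsub : ∀ t, (Subtype.val '' {f : (cycleMatroid G).E | x f < t}) ⊆ G.edgeSet := by
    rintro t _ ⟨f, -, rfl⟩
    exact f.2
  constructor
  · intro h1 u v huv
    rw [← mem_closure_cycleMatroid_iff (hsub _) huv]
    exact h1 ⟨s(u, v), huv⟩
  · rintro h1 ⟨e, he⟩
    induction e using Sym2.ind with
    | _ u v =>
      rw [mem_closure_cycleMatroid_iff (hsub _) he]
      exact h1 u v he

/-! ### Flats of the reduced weight graph -/

section Weights

variable {n : ℕ} {w : Fin n → ℚ} {h : Fin n}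

/-- The set `I` of ends has at least two elements, one of which is adjacent to all others in the
total weight graph; equivalently, `I` has at least two elements and its induced subgraph is
connected. -/
def IsStar (w : Fin n → ℚ) (I : Set (Fin n)) : Prop :=
  I.Nontrivial ∧ ∃ m ∈ I, ∀ x ∈ I, x ≠ m → 1 < w m + w x

/-- The edges of the reduced weight graph between elements of `I`. -/
def edgesIn (w : Fin n → ℚ) (h : Fin n) (I : Set (Fin n)) : Set (Sym2 (Others h)) :=
  {e | e ∈ (reducedWeightGraph w h).edgeSet ∧ ∀ i ∈ e, i.1 ∈ I}

theorem reducedWeightGraph_adj {i j : Others h} :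
    (reducedWeightGraph w h).Adj i j ↔ i ≠ j ∧ 1 < w i.1 + w j.1 := by
  rw [Ne, Subtype.ext_iff]
  rfl

theorem mk_mem_edgesIn {I : Set (Fin n)} {i j : Others h} :
    s(i, j) ∈ edgesIn w h I ↔
      (reducedWeightGraph w h).Adj i j ∧ i.1 ∈ I ∧ j.1 ∈ I := by
  refine and_congr Iff.rfl ⟨fun h1 => ⟨h1 i (Sym2.mem_mk_left _ _), h1 j (Sym2.mem_mk_right _ _)⟩,
    fun h1 z hz => ?_⟩
  rcases Sym2.mem_iff.1 hz with rfl | rfl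
  · exact h1.1
  · exact h1.2

theorem edgesIn_subset_edgeSet (I : Set (Fin n)) :
    edgesIn w h I ⊆ (reducedWeightGraph w h).edgeSet := fun _ he => he.1

theorem edgesIn_mono {I J : Set (Fin n)} (hIJ : I ⊆ J) : edgesIn w h I ⊆ edgesIn w h J :=
  fun _ he => ⟨he.1, fun i hi => hIJ (he.2 i hi)⟩

/-- In a threshold graph, a set without isolated vertices is connected: its vertex of largest weight
is adjacent to all others. -/
theorem isStar_of_forall_exists {I : Set (Fin n)} (hI : I.Nontrivial)
    (hadj : ∀ x ∈ I, ∃ y ∈ I, y ≠ x ∧ 1 < w x + w y) : IsStar w I := by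
  obtain ⟨m, hm, hmax⟩ := Set.exists_max_image I w (Set.toFinite _) hI.nonempty
  refine ⟨hI, m, hm, fun x hx _ => ?_⟩
  obtain ⟨y, hy, -, hxy⟩ := hadj x hx
  linarith [hmax y hy]

theorem IsStar.exists_adj {I : Set (Fin n)} (hI : IsStar w I) {x : Fin n} (hx : x ∈ I) :
    ∃ y ∈ I, y ≠ x ∧ 1 < w x + w y := by
  obtain ⟨hnt, m, hm, hadj⟩ := hI
  by_cases hxm : x = m
  · subst hxm
    obtain ⟨y, hy, hyx⟩ := hnt.exists_ne x
    exact ⟨y, hy, hyx, hadj y hy hyx⟩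
  · exact ⟨m, hm, Ne.symm hxm, by linarith [hadj x hx hxm]⟩

theorem IsStar.subset_of_edgesIn_subset {I J : Set (Fin n)} (hI : IsStar w I) (hhI : h ∉ I)
    (hIJ : edgesIn w h I ⊆ edgesIn w h J) : I ⊆ J := by
  intro x hx
  obtain ⟨y, hy, hyx, hxy⟩ := hI.exists_adj hx
  have hxh : x ≠ h := by rintro rfl; exact hhI hx
  have hyh : y ≠ h := by rintro rfl; exact hhI hy
  have h1 : s((⟨x, hxh⟩ : Others h), (⟨y, hyh⟩ : Others h)) ∈ edgesIn w h I :=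
    mk_mem_edgesIn.2 ⟨reducedWeightGraph_adj.2 ⟨fun h2 => hyx (Subtype.ext_iff.1 h2).symm, hxy⟩,
      hx, hy⟩
  exact (mk_mem_edgesIn.1 (hIJ h1)).2.1

theorem IsStar.edgesIn_injective {I J : Set (Fin n)} (hI : IsStar w I) (hhI : h ∉ I)
    (hJ : IsStar w J) (hhJ : h ∉ J) (hIJ : edgesIn w h I = edgesIn w h J) : I = J :=
  (hI.subset_of_edgesIn_subset hhI hIJ.subset).antisymm
    (hJ.subset_of_edgesIn_subset hhJ hIJ.symm.subset)

/-- Removing the isolated vertices of `I` leaves a connected set with the same edges. -/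
theorem exists_isStar_edgesIn_eq {I : Set (Fin n)} (hI : h ∉ I) (hne : (edgesIn w h I).Nonempty) :
    ∃ J, h ∉ J ∧ IsStar w J ∧ edgesIn w h I = edgesIn w h J := by
  refine ⟨{x | x ∈ I ∧ ∃ y ∈ I, y ≠ x ∧ 1 < w x + w y}, fun h1 => hI h1.1, ?_, ?_⟩
  · obtain ⟨e, he⟩ := hne
    induction e using Sym2.ind with
    | _ i j =>
      obtain ⟨hij, hi, hj⟩ := mk_mem_edgesIn.1 he
      obtain ⟨hij, hij'⟩ := reducedWeightGraph_adj.1 hij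
      have hij : i.1 ≠ j.1 := fun h1 => hij (Subtype.ext h1)
      refine isStar_of_forall_exists ⟨i.1, ⟨hi, j.1, hj, hij.symm, hij'⟩, j.1,
        ⟨hj, i.1, hi, hij, by rwa [add_comm]⟩, hij⟩ ?_
      rintro x ⟨hx, y, hy, hyx, hxy⟩
      exact ⟨y, ⟨hy, x, hx, hyx.symm, by rwa [add_comm]⟩, hyx, hxy⟩
  · refine Set.Subset.antisymm (fun e he => ?_) (edgesIn_mono fun x hx => hx.1)
    induction e using Sym2.ind with
    | _ i j =>
      obtain ⟨hadj, hi, hj⟩ := mk_mem_edgesIn.1 he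
      obtain ⟨hij, hij'⟩ := reducedWeightGraph_adj.1 hadj
      have hij : i.1 ≠ j.1 := fun h1 => hij (Subtype.ext h1)
      exact mk_mem_edgesIn.2 ⟨hadj, ⟨hi, j.1, hj, hij.symm, hij'⟩,
        ⟨hj, i.1, hi, hij, by rwa [add_comm]⟩⟩

theorem reachable_edgesIn {I : Set (Fin n)} (hI : IsStar w I) (hhI : h ∉ I) {i j : Others h}
    (hi : i.1 ∈ I) (hj : j.1 ∈ I) :
    (SimpleGraph.fromEdgeSet (edgesIn w h I)).Reachable i j := by
  obtain ⟨-, m, hm, hadj⟩ := hI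
  have hmh : m ≠ h := by rintro rfl; exact hhI hm
  have key : ∀ i : Others h, i.1 ∈ I →
      (SimpleGraph.fromEdgeSet (edgesIn w h I)).Reachable ⟨m, hmh⟩ i := by
    intro i hi
    by_cases him : i = ⟨m, hmh⟩
    · rw [him]
    · refine SimpleGraph.Adj.reachable ?_
      rw [SimpleGraph.fromEdgeSet_adj]
      refine ⟨mk_mem_edgesIn.2 ⟨reducedWeightGraph_adj.2 ⟨Ne.symm him, hadj _ hi fun h1 => ?_⟩,
        hm, hi⟩, Ne.symm him⟩
      exact him (Subtype.ext h1)
  exact (key i hi).symm.trans (key j hj)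

theorem mem_of_reachable_edgesIn {I : Set (Fin n)} {i j : Others h} (hi : i.1 ∈ I)
    (hr : (SimpleGraph.fromEdgeSet (edgesIn w h I)).Reachable i j) : j.1 ∈ I := by
  obtain ⟨q⟩ := hr
  induction q with
  | nil => exact hi
  | cons hadj _ ih =>
    rw [SimpleGraph.fromEdgeSet_adj] at hadj
    exact ih (mk_mem_edgesIn.1 hadj.1).2.2

/-- A vertex that is connected to a different vertex by a set of edges is the endpoint of one of
them. -/
theorem exists_mem_of_reachable {V : Type*} {X : Set (Sym2 V)} {u v : V} (huv : u ≠ v)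
    (hr : (SimpleGraph.fromEdgeSet X).Reachable u v) : ∃ z, s(u, z) ∈ X := by
  obtain ⟨q⟩ := hr
  cases q with
  | nil => exact absurd rfl huv
  | cons hadj _ =>
    rw [SimpleGraph.fromEdgeSet_adj] at hadj
    exact ⟨_, hadj.1⟩

theorem mem_oneConnectedFlats_iff {F : Set (Sym2 (Others h))} :
    F ∈ oneConnectedFlats (reducedWeightGraph w h) ↔
      ∃ I, h ∉ I ∧ IsStar w I ∧ edgesIn w h I = F := by
  constructor
  · rintro ⟨hF, hconn⟩
    rw [isFlat_cycleMatroid_iff] at hF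
    obtain ⟨hFE, hF⟩ := hF
    have hsupp : ∀ i : Others h, i ∈ (SimpleGraph.fromEdgeSet F).support →
        ∃ j ∈ (SimpleGraph.fromEdgeSet F).support, s(i, j) ∈ F := by
      intro i hi
      obtain ⟨j, hj⟩ := (SimpleGraph.mem_support _).1 hi
      exact ⟨j, (SimpleGraph.mem_support _).2 ⟨i, hj.symm⟩,
        ((SimpleGraph.fromEdgeSet_adj F).1 hj).1⟩
    have hadj : ∀ i j : Others h, s(i, j) ∈ F → i.1 ≠ j.1 ∧ 1 < w i.1 + w j.1 := by
      intro i j hij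
      have h1 := reducedWeightGraph_adj.1 (hFE hij)
      exact ⟨fun h2 => h1.1 (Subtype.ext h2), h1.2⟩
    refine ⟨Subtype.val '' (SimpleGraph.fromEdgeSet F).support, ?_, ?_, ?_⟩
    · rintro ⟨i, -, hi⟩
      exact i.2 hi
    · apply isStar_of_forall_exists
      · obtain ⟨⟨i, hi⟩⟩ := hconn.nonempty
        obtain ⟨j, hj, hij⟩ := hsupp i hi
        exact ⟨i.1, ⟨i, hi, rfl⟩, j.1, ⟨j, hj, rfl⟩, (hadj i j hij).1⟩
      · rintro _ ⟨i, hi, rfl⟩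
        obtain ⟨j, hj, hij⟩ := hsupp i hi
        exact ⟨j.1, ⟨j, hj, rfl⟩, (hadj i j hij).1.symm, (hadj i j hij).2⟩
    · ext e
      induction e using Sym2.ind with
      | _ i j =>
        rw [mk_mem_edgesIn]
        constructor
        · rintro ⟨hij, ⟨i', hi, hi'⟩, ⟨j', hj, hj'⟩⟩
          obtain rfl := Subtype.ext hi'
          obtain rfl := Subtype.ext hj'
          refine hF _ _ hij ?_
          exact (hconn.preconnected ⟨i', hi⟩ ⟨j', hj⟩).map
            (SimpleGraph.Embedding.induce _).toHom
        · intro hij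
          have h1 : (SimpleGraph.fromEdgeSet F).Adj i j := by
            rw [SimpleGraph.fromEdgeSet_adj]
            exact ⟨hij, SimpleGraph.Adj.ne (G := reducedWeightGraph w h) (hFE hij)⟩
          exact ⟨hFE hij, ⟨i, (SimpleGraph.mem_support _).2 ⟨j, h1⟩, rfl⟩,
            ⟨j, (SimpleGraph.mem_support _).2 ⟨i, h1.symm⟩, rfl⟩⟩
  · rintro ⟨I, hhI, hI, rfl⟩
    have hsupp : ∀ i : Others h,
        i ∈ (SimpleGraph.fromEdgeSet (edgesIn w h I)).support ↔ i.1 ∈ I := by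
      intro i
      rw [SimpleGraph.mem_support]
      constructor
      · rintro ⟨j, hij⟩
        rw [SimpleGraph.fromEdgeSet_adj] at hij
        exact (mk_mem_edgesIn.1 hij.1).2.1
      · intro hi
        obtain ⟨y, hy, hyi, hiy⟩ := hI.exists_adj hi
        have hyh : y ≠ h := by rintro rfl; exact hhI hy
        have hne : i ≠ ⟨y, hyh⟩ := by rintro rfl; exact hyi rfl
        refine ⟨⟨y, hyh⟩, ?_⟩
        rw [SimpleGraph.fromEdgeSet_adj]
        exact ⟨mk_mem_edgesIn.2 ⟨reducedWeightGraph_adj.2 ⟨hne, hiy⟩, hi, hy⟩, hne⟩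
    refine ⟨isFlat_cycleMatroid_iff.2 ⟨edgesIn_subset_edgeSet I, fun u v huv hr => ?_⟩, ?_⟩
    · obtain ⟨z, hz⟩ := exists_mem_of_reachable huv.ne hr
      have hu := (mk_mem_edgesIn.1 hz).2.1
      exact mk_mem_edgesIn.2 ⟨huv, hu, mem_of_reachable_edgesIn hu hr⟩
    · -- A walk in the graph formed by the edges runs through their endpoints only.
      have hind : ∀ {i j : Others h}
          (q : (SimpleGraph.fromEdgeSet (edgesIn w h I)).Walk i j)
          (hi : i ∈ (SimpleGraph.fromEdgeSet (edgesIn w h I)).support)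
          (hj : j ∈ (SimpleGraph.fromEdgeSet (edgesIn w h I)).support),
          ((SimpleGraph.fromEdgeSet (edgesIn w h I)).induce
            (SimpleGraph.fromEdgeSet (edgesIn w h I)).support).Reachable ⟨i, hi⟩ ⟨j, hj⟩ := by
        intro i j q
        induction q with
        | nil => exact fun _ _ => SimpleGraph.Reachable.refl _
        | @cons a b c hab q ih =>
          intro hi hj
          have hb : b ∈ (SimpleGraph.fromEdgeSet (edgesIn w h I)).support :=
            (SimpleGraph.mem_support _).2 ⟨a, hab.symm⟩
          refine SimpleGraph.Reachable.trans (v := ⟨b, hb⟩) ?_ (ih hb hj)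
          exact SimpleGraph.Adj.reachable (by simpa using hab)
      obtain ⟨x, hx⟩ := hI.1.nonempty
      have hxh : x ≠ h := by rintro rfl; exact hhI hx
      exact
        { preconnected := fun i j => by
            obtain ⟨q⟩ := reachable_edgesIn hI hhI ((hsupp i).1 i.2) ((hsupp j).1 j.2)
            exact hind q i.2 j.2
          nonempty := ⟨⟨⟨x, hxh⟩, (hsupp _).2 hx⟩⟩ }

/-- Flats of disjoint sets have a disconnected join, even if there are edges between the sets: no
such edge is in the closure. -/
theorem isNested_edgesIn {𝓕 : Set (Set (Fin n))} (h𝓕 : IsLaminar 𝓕) :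
    IsNested (cycleMatroid (reducedWeightGraph w h)) (oneConnectedFlats (reducedWeightGraph w h))
      (edgesIn w h '' 𝓕 ∩ oneConnectedFlats (reducedWeightGraph w h)) := by
  refine ⟨Set.inter_subset_right, fun A hA hnt hanti hmem => ?_⟩
  have hAE : ⋃₀ A ⊆ (reducedWeightGraph w h).edgeSet := by
    refine Set.sUnion_subset fun F hF => ?_
    obtain ⟨⟨I, -, rfl⟩, -⟩ := hA hF
    exact edgesIn_subset_edgeSet I
  have hcmp : ∀ I ∈ 𝓕, ∀ J ∈ 𝓕, edgesIn w h I ∈ A → edgesIn w h J ∈ A → ∀ x, x ∈ I → x ∈ J →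
      edgesIn w h I = edgesIn w h J := by
    intro I hI J hJ hIA hJA x hxI hxJ
    by_contra hne
    rcases h𝓕 I hI J hJ with h1 | h1 | h1
    · exact hanti hIA hJA hne (edgesIn_mono h1)
    · exact hanti hJA hIA (Ne.symm hne) (edgesIn_mono h1)
    · exact Set.disjoint_left.1 h1 hxI hxJ
  have hne : ∀ F ∈ A, ∃ i j : Others h, s(i, j) ∈ F := by
    intro F hF
    obtain ⟨-, -, hconn⟩ := hA hF
    obtain ⟨⟨i, hi⟩⟩ := hconn.nonempty
    obtain ⟨j, hj⟩ := (SimpleGraph.mem_support _).1 hi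
    rw [SimpleGraph.fromEdgeSet_adj] at hj
    exact ⟨i, j, hj.1⟩
  obtain ⟨J, hhJ, hJ, hJA⟩ := mem_oneConnectedFlats_iff.1 hmem
  have hJmem : ∀ F ∈ A, ∀ i j, s(i, j) ∈ F → i.1 ∈ J := by
    intro F hF i j hij
    have h1 := (cycleMatroid (reducedWeightGraph w h)).subset_closure _ hAE ⟨F, hF, hij⟩
    rw [← hJA] at h1
    exact (mk_mem_edgesIn.1 h1).2.1
  have hreach : ∀ i j : Others h, i.1 ∈ J → j.1 ∈ J →
      (SimpleGraph.fromEdgeSet (⋃₀ A)).Reachable i j := by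
    intro i j hi hj
    obtain ⟨q⟩ := reachable_edgesIn hJ hhJ hi hj
    clear hi hj
    induction q with
    | nil => exact SimpleGraph.Reachable.refl _
    | cons hab _ ih =>
      rw [SimpleGraph.fromEdgeSet_adj] at hab
      refine SimpleGraph.Reachable.trans ?_ ih
      rw [← mem_closure_cycleMatroid_iff hAE (mk_mem_edgesIn.1 hab.1).1, ← hJA]
      exact hab.1
  obtain ⟨F₁, hF₁, F₂, hF₂, h12⟩ := hnt
  obtain ⟨a, b, hab⟩ := hne F₁ hF₁
  obtain ⟨c, d, hcd⟩ := hne F₂ hF₂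
  obtain ⟨⟨I₁, hI₁, rfl⟩, -⟩ := hA hF₁
  obtain ⟨⟨I₂, hI₂, rfl⟩, -⟩ := hA hF₂
  -- A walk along the edges of the antichain cannot leave `I₁`.
  have hstay : ∀ i j : Others h, (SimpleGraph.fromEdgeSet (⋃₀ A)).Reachable i j →
      i.1 ∈ I₁ → j.1 ∈ I₁ := by
    rintro i j ⟨q⟩ hi
    induction q with
    | nil => exact hi
    | cons hadj _ ih =>
      rw [SimpleGraph.fromEdgeSet_adj] at hadj
      obtain ⟨⟨F, hF, huv⟩, -⟩ := hadj
      obtain ⟨⟨I, hI, rfl⟩, -⟩ := hA hF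
      have h1 := hcmp I hI I₁ hI₁ hF hF₁ _ (mk_mem_edgesIn.1 huv).2.1 hi
      rw [h1] at huv
      exact ih (mk_mem_edgesIn.1 huv).2.2
  have hc : c.1 ∈ I₁ := hstay a c (hreach a c (hJmem _ hF₁ a b hab) (hJmem _ hF₂ c d hcd))
    (mk_mem_edgesIn.1 hab).2.1
  exact h12 (hcmp I₁ hI₁ I₂ hI₂ hF₁ hF₂ _ hc (mk_mem_edgesIn.1 hcd).2.1)

/-- If two connected sets meet, the join of their flats is the flat of their union. -/
theorem isLaminar_of_isNested {S : Set (Set (Sym2 (Others h)))}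
    (hS : IsNested (cycleMatroid (reducedWeightGraph w h))
      (oneConnectedFlats (reducedWeightGraph w h)) S) :
    IsLaminar {I | h ∉ I ∧ IsStar w I ∧ edgesIn w h I ∈ S} := by
  rintro I ⟨hhI, hI, hIS⟩ J ⟨hhJ, hJ, hJS⟩
  by_contra hcon
  push Not at hcon
  obtain ⟨hIJ, hJI, hdisj⟩ := hcon
  obtain ⟨x, hxI, hxJ⟩ := Set.not_disjoint_iff.1 hdisj
  have hIJ' : ¬ edgesIn w h I ⊆ edgesIn w h J := fun h1 =>
    hIJ (hI.subset_of_edgesIn_subset hhI h1)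
  have hJI' : ¬ edgesIn w h J ⊆ edgesIn w h I := fun h1 =>
    hJI (hJ.subset_of_edgesIn_subset hhJ h1)
  have hxh : x ≠ h := by rintro rfl; exact hhI hxI
  have hsub : edgesIn w h I ∪ edgesIn w h J ⊆ (reducedWeightGraph w h).edgeSet :=
    Set.union_subset (edgesIn_subset_edgeSet I) (edgesIn_subset_edgeSet J)
  have hhIJ : h ∉ I ∪ J := fun h1 => h1.elim hhI hhJ
  have hstar : IsStar w (I ∪ J) := by
    refine isStar_of_forall_exists (hI.1.mono Set.subset_union_left) ?_
    rintro y (hy | hy)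
    · obtain ⟨z, hz, h1⟩ := hI.exists_adj hy
      exact ⟨z, Or.inl hz, h1⟩
    · obtain ⟨z, hz, h1⟩ := hJ.exists_adj hy
      exact ⟨z, Or.inr hz, h1⟩
  refine hS.2 {edgesIn w h I, edgesIn w h J} ?_ ?_ ?_ ?_
  · rintro _ (rfl | rfl)
    · exact hIS
    · exact hJS
  · exact Set.nontrivial_pair fun h1 => hIJ' h1.subset
  · rintro _ (rfl | rfl) _ (rfl | rfl) hne
    · exact absurd rfl hne
    · exact hIJ'
    · exact hJI'
    · exact absurd rfl hne
  · refine mem_oneConnectedFlats_iff.2 ⟨I ∪ J, hhIJ, hstar, ?_⟩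
    rw [Set.sUnion_pair]
    have key : ∀ i : Others h, i.1 ∈ I ∪ J →
        (SimpleGraph.fromEdgeSet (edgesIn w h I ∪ edgesIn w h J)).Reachable i ⟨x, hxh⟩ := by
      rintro i (hi | hi)
      · exact (reachable_edgesIn hI hhI hi hxI).mono
          (SimpleGraph.fromEdgeSet_mono Set.subset_union_left)
      · exact (reachable_edgesIn hJ hhJ hi hxJ).mono
          (SimpleGraph.fromEdgeSet_mono Set.subset_union_right)
    ext e
    induction e using Sym2.ind with
    | _ i j =>
      constructor
      · intro hij
        obtain ⟨hadj, hi, hj⟩ := mk_mem_edgesIn.1 hij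
        exact (mem_closure_cycleMatroid_iff hsub hadj).2 ((key i hi).trans (key j hj).symm)
      · intro hij
        have hadj : (reducedWeightGraph w h).Adj i j :=
          (cycleMatroid (reducedWeightGraph w h)).closure_subset_ground _ hij
        have hr := (mem_closure_cycleMatroid_iff hsub hadj).1 hij
        have hend : ∀ i z : Others h, s(i, z) ∈ edgesIn w h I ∪ edgesIn w h J → i.1 ∈ I ∪ J := by
          rintro i z (hz | hz)
          · exact Or.inl (mk_mem_edgesIn.1 hz).2.1
          · exact Or.inr (mk_mem_edgesIn.1 hz).2.1
        obtain ⟨z, hz⟩ := exists_mem_of_reachable hadj.ne hr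
        obtain ⟨z', hz'⟩ := exists_mem_of_reachable hadj.ne' hr.symm
        exact mk_mem_edgesIn.2 ⟨hadj, hend i z hz, hend j z' hz'⟩

/-! ### The images of the rays -/

open Classical in
theorem prW_splitVec {I : Set (Fin n)} (hI : h ∉ I) :
    prW h w (splitVec I) =
      flatVec (cycleMatroid (reducedWeightGraph w h)) (edgesIn w h I) := by
  unfold prW splitVec flatVec
  rw [LinearMap.comp_apply, moduliToBergman, forgetEdges, Submodule.mkQ_apply,
    Submodule.mapQ_apply, Submodule.mapQ_apply, Submodule.mkQ_apply]
  congr 1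
  ext ⟨e, he⟩
  induction e using Sym2.ind with
  | _ i j =>
    have hij : i ≠ j := SimpleGraph.Adj.ne (G := reducedWeightGraph w h) he
    have hmem : s(i, j) ∈ edgesIn w h I ↔ i.1 ∈ I ∧ j.1 ∈ I :=
      mk_mem_edgesIn.trans (and_iff_right he)
    simp only [LinearMap.funLeft_apply, gromovMap, LinearMap.coe_mk, AddHom.coe_mk, pairVec,
      Sym2.map_mk, Sym2.lift_mk, Sym2.toFinset_mk_eq, Finset.sum_pair hij, hI, false_iff]
    by_cases hi : i.1 ∈ I <;> by_cases hj : j.1 ∈ I <;>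
      simp [Set.indicator, hmem, hi, hj]

theorem flatVec_edgesIn_compl :
    flatVec (cycleMatroid (reducedWeightGraph w h)) (edgesIn w h {h}ᶜ) = 0 := by
  unfold flatVec
  rw [Submodule.mkQ_apply, Submodule.Quotient.mk_eq_zero, lineality, Submodule.mem_span_singleton]
  refine ⟨-1, ?_⟩
  ext e
  have he : (e : Sym2 (Others h)) ∈ edgesIn w h {h}ᶜ := ⟨e.2, fun i _ => i.2⟩
  simp [Set.indicator, he]

theorem flatVec_empty {α : Type*} (M : Matroid α) : flatVec M ∅ = 0 := by
  unfold flatVec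
  simp only [Set.indicator_empty, neg_zero]
  exact map_zero _

end Weights

/-! ### Coefficients with respect to the rays -/

section Hull

variable {ι E : Type*} [Fintype ι] [AddCommGroup E] [Module ℝ E]

theorem mem_hull_image_iff (f : ι → E) (s : Set ι) (x : E) :
    x ∈ PointedCone.hull ℝ (f '' s) ↔
      ∃ c : ι → ℝ, (∀ i, 0 ≤ c i) ∧ (∀ i, i ∉ s → c i = 0) ∧ x = ∑ i, c i • f i := by
  classical
  constructor
  · intro hx
    induction hx using Submodule.span_induction with
    | mem x hx =>
      obtain ⟨i, hi, rfl⟩ := hx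
      refine ⟨Pi.single i 1, fun j => ?_, fun j hj => ?_, ?_⟩
      · by_cases hij : j = i
        · subst hij; simp
        · simp [hij]
      · exact Pi.single_eq_of_ne (by rintro rfl; exact hj hi) 1
      · simp [Pi.single_apply]
    | zero => exact ⟨0, fun _ => le_rfl, fun _ _ => rfl, by simp⟩
    | add x y _ _ hx hy =>
      obtain ⟨c, hc, hc', rfl⟩ := hx
      obtain ⟨d, hd, hd', rfl⟩ := hy
      refine ⟨c + d, fun i => add_nonneg (hc i) (hd i), fun i hi => ?_, ?_⟩
      · simp [hc' i hi, hd' i hi]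
      · simp [add_smul, Finset.sum_add_distrib]
    | smul a x _ hx =>
      obtain ⟨c, hc, hc', rfl⟩ := hx
      refine ⟨fun i => (a : ℝ) * c i, fun i => mul_nonneg a.2 (hc i), fun i hi => ?_, ?_⟩
      · simp [hc' i hi]
      · rw [Finset.smul_sum]
        refine Finset.sum_congr rfl fun i _ => ?_
        rw [mul_smul]
        rfl
  · rintro ⟨c, hc, hc', rfl⟩
    refine Submodule.sum_mem _ fun i _ => ?_
    by_cases hi : i ∈ s
    · exact Submodule.smul_mem _ (⟨c i, hc i⟩ : {c : ℝ // 0 ≤ c})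
        (Submodule.subset_span (Set.mem_image_of_mem f hi))
    · rw [hc' i hi, zero_smul]
      exact Submodule.zero_mem _

theorem exists_sum_of_mem_span_image (f : ι → E) (s : Set ι) {x : E}
    (hx : x ∈ Submodule.span ℝ (f '' s)) :
    ∃ c : ι → ℝ, (∀ i, i ∉ s → c i = 0) ∧ x = ∑ i, c i • f i := by
  classical
  induction hx using Submodule.span_induction with
  | mem x hx =>
    obtain ⟨i, hi, rfl⟩ := hx
    exact ⟨Pi.single i 1, fun j hj => Pi.single_eq_of_ne (by rintro rfl; exact hj hi) 1,
      by simp [Pi.single_apply]⟩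
  | zero => exact ⟨0, fun _ _ => rfl, by simp⟩
  | add x y _ _ hx hy =>
    obtain ⟨c, hc, rfl⟩ := hx
    obtain ⟨d, hd, rfl⟩ := hy
    exact ⟨c + d, fun i hi => by simp [hc i hi, hd i hi],
      by simp [add_smul, Finset.sum_add_distrib]⟩
  | smul a x _ hx =>
    obtain ⟨c, hc, rfl⟩ := hx
    exact ⟨fun i => a * c i, fun i hi => by simp [hc i hi], by simp [Finset.smul_sum, mul_smul]⟩

end Hull

section Coefficients

variable {n : ℕ} {w : Fin n → ℚ} {h : Fin n}

/-- The image under `pr_w` of the vector `v_I`, for `I` not containing `h`. -/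
def rayVec (w : Fin n → ℚ) (h : Fin n) (I : Set (Fin n)) :
    BergmanSpace (cycleMatroid (reducedWeightGraph w h)) :=
  flatVec (cycleMatroid (reducedWeightGraph w h)) (edgesIn w h I)

open Classical in
theorem sum_smul_rayVec (c : Set (Fin n) → ℝ) :
    ∑ I, c I • rayVec w h I = (lineality (cycleMatroid (reducedWeightGraph w h))).mkQ
      fun e => -∑ I, if (e : Sym2 (Others h)) ∈ edgesIn w h I then c I else 0 := by
  unfold rayVec flatVec
  refine (map_sum (lineality (cycleMatroid (reducedWeightGraph w h))).mkQ
    (fun I => c I • fun e : (cycleMatroid (reducedWeightGraph w h)).E =>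
      -((edgesIn w h I).indicator (fun _ => (1 : ℝ)) (e : Sym2 (Others h)))) Finset.univ).symm.trans
    (congrArg _ ?_)
  ext e
  rw [Finset.sum_apply, ← Finset.sum_neg_distrib]
  refine Finset.sum_congr rfl fun I _ => ?_
  by_cases he : (e : Sym2 (Others h)) ∈ edgesIn w h I <;> simp [he]

theorem prW_sum {c : Set (Fin n) → ℝ} (hc : ∀ I, h ∈ I → c I = 0) :
    prW h w (∑ I, c I • splitVec I) = ∑ I, c I • rayVec w h I := by
  rw [map_sum]
  refine Finset.sum_congr rfl fun I _ => ?_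
  by_cases hI : h ∈ I
  · rw [hc I hI, zero_smul, zero_smul, map_zero]
  · rw [map_smul, prW_splitVec hI, rayVec]

/-- A connected set is not covered by the smaller members of a laminar family: if `m` is adjacent to
all of `A` and `x ∈ A` is not in the largest member of the family that contains `m` but not `A`,
then no such member contains both `m` and `x`. -/
theorem exists_edge_forall_subset {A : Set (Fin n)} (hA : IsStar w A) (hhA : h ∉ A)
    {𝓕 : Set (Set (Fin n))} (h𝓕 : IsLaminar 𝓕) :
    ∃ e : (cycleMatroid (reducedWeightGraph w h)).E, (e : Sym2 (Others h)) ∈ edgesIn w h A ∧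
      ∀ B ∈ 𝓕, (e : Sym2 (Others h)) ∈ edgesIn w h B → A ⊆ B := by
  obtain ⟨hnt, m, hm, hadj⟩ := hA
  have hmh : m ≠ h := by rintro rfl; exact hhA hm
  obtain ⟨x, hx, hxm, hxB⟩ : ∃ x ∈ A, x ≠ m ∧ ∀ B ∈ 𝓕, m ∈ B → x ∈ B → A ⊆ B := by
    by_cases hne : {B | B ∈ 𝓕 ∧ m ∈ B ∧ ¬ A ⊆ B}.Nonempty
    · obtain ⟨B₀, ⟨hB₀, hmB₀, hAB₀⟩, hmax⟩ := Set.exists_max_image _ Set.ncard (Set.toFinite _) hne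
      obtain ⟨x, hx, hxB₀⟩ := Set.not_subset.1 hAB₀
      refine ⟨x, hx, by rintro rfl; exact hxB₀ hmB₀, fun B hB hmB hxB => ?_⟩
      by_contra hAB
      rcases h𝓕 B hB B₀ hB₀ with h1 | h1 | h1
      · exact hxB₀ (h1 hxB)
      · rw [Set.eq_of_subset_of_ncard_le h1 (hmax B ⟨hB, hmB, hAB⟩)] at hxB₀
        exact hxB₀ hxB
      · exact Set.disjoint_left.1 h1 hmB hmB₀
    · obtain ⟨x, hx, hxm⟩ := hnt.exists_ne m
      refine ⟨x, hx, hxm, fun B hB hmB _ => ?_⟩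
      by_contra hAB
      exact hne ⟨B, hB, hmB, hAB⟩
  have hxh : x ≠ h := by rintro rfl; exact hhA hx
  have hadj' : (reducedWeightGraph w h).Adj ⟨m, hmh⟩ ⟨x, hxh⟩ :=
    reducedWeightGraph_adj.2 ⟨fun h1 => hxm (Subtype.ext_iff.1 h1).symm, hadj x hx hxm⟩
  refine ⟨⟨s(⟨m, hmh⟩, ⟨x, hxh⟩), hadj'⟩, mk_mem_edgesIn.2 ⟨hadj', hm, hx⟩, fun B hB he => ?_⟩
  obtain ⟨-, hmB, hxB'⟩ := mk_mem_edgesIn.1 he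
  exact hxB B hB hmB hxB'

/-- There is an edge that joins no two elements of the same proper member of a laminar family. -/
theorem exists_edge_forall_notMem (hN : IsStar w {h}ᶜ) {𝓕 : Set (Set (Fin n))}
    (h𝓕 : IsCladeFamily h 𝓕) :
    ∃ e : (cycleMatroid (reducedWeightGraph w h)).E,
      ∀ B ∈ 𝓕, (e : Sym2 (Others h)) ∉ edgesIn w h B := by
  obtain ⟨e, -, he⟩ := exists_edge_forall_subset hN (fun h1 => h1 rfl) h𝓕.laminar
  refine ⟨e, fun B hB h1 => h𝓕.ne_compl B hB (Set.Subset.antisymm ?_ (he B hB h1))⟩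
  rintro x hx rfl
  exact h𝓕.notMem B hB hx

theorem mkQ_lineality_eq_iff {α : Type*} {M : Matroid α} {x y : M.E → ℝ} :
    (lineality M).mkQ x = (lineality M).mkQ y ↔ ∃ t : ℝ, ∀ e, x e = y e + t := by
  rw [Submodule.mkQ_apply, Submodule.mkQ_apply, Submodule.Quotient.eq, lineality,
    Submodule.mem_span_singleton]
  refine exists_congr fun t => ?_
  rw [funext_iff]
  refine forall_congr' fun e => ?_
  simp only [Pi.smul_apply, Pi.sub_apply, smul_eq_mul, mul_one]
  constructor <;> intro h1 <;> linarith

/-- The coefficients with respect to the rays of a nested cone lie in any subgroup that contains the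
coordinates of some representative. For the zero subgroup this is linear independence, for the
integers it says that the rays generate a saturated sublattice. -/
theorem coeff_mem (hN : IsStar w {h}ᶜ) {𝓕 : Set (Set (Fin n))} (h𝓕 : IsCladeFamily h 𝓕)
    (hstar : ∀ I ∈ 𝓕, IsStar w I) (H : AddSubgroup ℝ) {c : Set (Fin n) → ℝ}
    (hc : ∀ I, I ∉ 𝓕 → c I = 0) {x : (cycleMatroid (reducedWeightGraph w h)).E → ℝ}
    (hx : ∀ e, x e ∈ H) (hsum : ∑ I, c I • rayVec w h I = (lineality _).mkQ x)
    (I : Set (Fin n)) : c I ∈ H := by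
  classical
  rw [sum_smul_rayVec, eq_comm, mkQ_lineality_eq_iff] at hsum
  obtain ⟨t, ht⟩ := hsum
  have htH : t ∈ H := by
    obtain ⟨e, he⟩ := exists_edge_forall_notMem hN h𝓕
    have h1 := ht e
    rw [Finset.sum_eq_zero, neg_zero, zero_add] at h1
    · exact h1 ▸ hx e
    · intro B _
      by_cases hB : B ∈ 𝓕
      · rw [if_neg (he B hB)]
      · rw [hc B hB, ite_self]
  have hup : ∀ A ∈ 𝓕, ∑ B, (if A ⊆ B then c B else 0) ∈ H := by
    intro A hA
    obtain ⟨e, heA, he⟩ := exists_edge_forall_subset (hstar A hA) (h𝓕.notMem A hA) h𝓕.laminar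
    have h1 : ∑ B, (if A ⊆ B then c B else 0) = t - x e := by
      rw [ht e]
      have h2 : ∀ B, (if A ⊆ B then c B else 0) =
          if (e : Sym2 (Others h)) ∈ edgesIn w h B then c B else 0 := by
        intro B
        by_cases hB : B ∈ 𝓕
        · exact if_congr ⟨fun h3 => edgesIn_mono h3 heA, he B hB⟩ rfl rfl
        · rw [hc B hB, ite_self, ite_self]
      rw [Finset.sum_congr rfl fun B _ => h2 B]
      ring
    rw [h1]
    exact H.sub_mem htH (hx e)
  induction hk : (Iᶜ).ncard using Nat.strong_induction_on generalizing I with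
  | _ k ih =>
    by_cases hI : I ∈ 𝓕
    · have h1 := hup I hI
      rw [← Finset.add_sum_erase _ _ (Finset.mem_univ I), if_pos subset_rfl] at h1
      refine (H.add_mem_cancel_right (H.sum_mem fun B hB => ?_)).1 h1
      by_cases hIB : I ⊆ B
      · rw [if_pos hIB]
        refine ih _ ?_ B rfl
        rw [← hk]
        exact Set.ncard_lt_ncard (compl_lt_compl_iff_lt.2
          (hIB.ssubset_of_ne (Finset.ne_of_mem_erase hB).symm))
      · rw [if_neg hIB]
        exact H.zero_mem
    · rw [hc I hI]
      exact H.zero_mem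

/-- A ray that lies in a nested cone is one of its generators. -/
theorem mem_of_rayVec_mem_hull (hN : IsStar w {h}ᶜ) {𝓕 : Set (Set (Fin n))}
    (h𝓕 : IsCladeFamily h 𝓕) (hstar : ∀ I ∈ 𝓕, IsStar w I) {A : Set (Fin n)} (hA : IsStar w A)
    (hhA : h ∉ A) (hAne : A ≠ {h}ᶜ)
    (hmem : rayVec w h A ∈ PointedCone.hull ℝ (rayVec w h '' 𝓕)) : A ∈ 𝓕 := by
  classical
  obtain ⟨c, hc, hc0, hsum⟩ := (mem_hull_image_iff _ _ _).1 hmem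
  rw [sum_smul_rayVec, rayVec, flatVec, mkQ_lineality_eq_iff] at hsum
  obtain ⟨t, ht⟩ := hsum
  have hnn : ∀ (e : (cycleMatroid (reducedWeightGraph w h)).E) (B : Set (Fin n)),
      0 ≤ if (e : Sym2 (Others h)) ∈ edgesIn w h B then c B else 0 := by
    intro e B
    split_ifs
    · exact hc B
    · exact le_rfl
  have hsum0 : ∀ e : (cycleMatroid (reducedWeightGraph w h)).E,
      0 ≤ ∑ B, if (e : Sym2 (Others h)) ∈ edgesIn w h B then c B else 0 :=
    fun e => Finset.sum_nonneg fun B _ => hnn e B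
  have ht0 : t = 0 := by
    apply ge_antisymm
    · obtain ⟨e, heA⟩ : ∃ e : (cycleMatroid (reducedWeightGraph w h)).E,
          (e : Sym2 (Others h)) ∉ edgesIn w h A := by
        by_contra hcon
        push Not at hcon
        refine hAne (hA.edgesIn_injective hhA hN (fun h1 => h1 rfl) (Set.Subset.antisymm ?_ ?_))
        · exact edgesIn_mono fun x hx hxh => by
            rw [Set.mem_singleton_iff.1 hxh] at hx
            exact hhA hx
        · exact fun e he => hcon ⟨e, he.1⟩
      have h1 := ht e
      rw [Set.indicator_of_notMem heA] at h1
      linarith [hsum0 e]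
    · obtain ⟨e, he⟩ := exists_edge_forall_notMem hN h𝓕
      have h1 := ht e
      rw [Finset.sum_eq_zero] at h1
      · have : 0 ≤ (edgesIn w h A).indicator (fun _ => (1 : ℝ)) (e : Sym2 (Others h)) :=
          Set.indicator_nonneg (fun _ _ => zero_le_one) _
        linarith
      · intro B _
        by_cases hB : B ∈ 𝓕
        · rw [if_neg (he B hB)]
        · rw [hc0 B hB, ite_self]
  subst ht0
  obtain ⟨e, heA, he⟩ := exists_edge_forall_subset hA hhA h𝓕.laminar
  have h1 := ht e
  rw [Set.indicator_of_mem heA] at h1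
  obtain ⟨B, -, hB⟩ : ∃ B ∈ Finset.univ,
      (if (e : Sym2 (Others h)) ∈ edgesIn w h B then c B else 0) ≠ 0 := by
    refine Finset.exists_ne_zero_of_sum_ne_zero fun h2 => ?_
    rw [h2] at h1
    norm_num at h1
  have heB : (e : Sym2 (Others h)) ∈ edgesIn w h B := by
    by_contra h2
    exact hB (if_neg h2)
  rw [if_pos heB] at hB
  have hB𝓕 : B ∈ 𝓕 := by
    by_contra h2
    exact hB (hc0 B h2)
  have hBA : edgesIn w h B ⊆ edgesIn w h A := by
    intro f hf
    by_contra hfA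
    have h2 := ht ⟨f, hf.1⟩
    rw [Set.indicator_of_notMem hfA, neg_zero, add_zero, zero_eq_neg] at h2
    have h3 := (Finset.sum_eq_zero_iff_of_nonneg fun B _ => hnn ⟨f, hf.1⟩ B).1 h2 B
      (Finset.mem_univ B)
    rw [if_pos hf] at h3
    exact hB h3
  rw [(he B hB𝓕 heB).antisymm ((hstar B hB𝓕).subset_of_edgesIn_subset (h𝓕.notMem B hB𝓕) hBA)]
  exact hB𝓕

theorem hull_rayVec_le_iff (hN : IsStar w {h}ᶜ) {𝓕 𝓕' : Set (Set (Fin n))}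
    (h𝓕 : IsCladeFamily h 𝓕) (hstar : ∀ I ∈ 𝓕, IsStar w I)
    (h𝓕' : IsCladeFamily h 𝓕') (hstar' : ∀ I ∈ 𝓕', IsStar w I) :
    PointedCone.hull ℝ (rayVec w h '' 𝓕) ≤ PointedCone.hull ℝ (rayVec w h '' 𝓕') ↔ 𝓕 ⊆ 𝓕' := by
  refine ⟨fun hle A hA => ?_, fun hsub => Submodule.span_mono (Set.image_mono hsub)⟩
  exact mem_of_rayVec_mem_hull hN h𝓕' hstar' (hstar A hA) (h𝓕.notMem A hA) (h𝓕.ne_compl A hA)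
    (hle (Submodule.subset_span (Set.mem_image_of_mem _ hA)))

theorem CombType.map_cone_eq (T : CombType n) :
    T.cone.map (prW h w) = PointedCone.hull ℝ (rayVec w h '' T.clades h) := by
  rw [T.cone_eq h]
  refine (Submodule.map_span _ _).trans ?_
  unfold PointedCone.hull
  congr 1
  rw [Set.image_image]
  exact Set.image_congr fun I hI => prW_splitVec hI.1

end Coefficients

/-! ### Surviving combinatorial types -/

section Survives

variable {n : ℕ} {w : Fin n → ℚ} {h : Fin n}

theorem isStar_one_iff {I : Set (Fin n)} : IsStar (fun _ => 1) I ↔ I.Nontrivial := by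
  refine ⟨And.left, fun hI => ⟨hI, ?_⟩⟩
  obtain ⟨m, hm⟩ := hI.nonempty
  exact ⟨m, hm, fun _ _ _ => by norm_num⟩

theorem nontrivial_compl_singleton (hn : 3 ≤ n) (h : Fin n) : ({h}ᶜ : Set (Fin n)).Nontrivial := by
  rw [← Set.one_lt_ncard_iff_nontrivial, Set.ncard_compl, Set.ncard_singleton, Nat.card_fin]
  omega

/-- Inclusions of cones of combinatorial types are inclusions of the families of clades; this is the
statement on nested cones for the complete graph, in which all sets are connected. -/
theorem CombType.clades_subset_of_cone_le (hn : 3 ≤ n) (h : Fin n) {T T' : CombType n}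
    (hle : T.cone ≤ T'.cone) : T.clades h ⊆ T'.clades h := by
  rw [← hull_rayVec_le_iff (w := fun _ => 1) (isStar_one_iff.2 (nontrivial_compl_singleton hn h))
    (T.isCladeFamily_clades h)
    (fun I hI => isStar_one_iff.2 ((T.isCladeFamily_clades h).nontrivial I hI))
    (T'.isCladeFamily_clades h)
    (fun I hI => isStar_one_iff.2 ((T'.isCladeFamily_clades h).nontrivial I hI)),
    ← T.map_cone_eq, ← T'.map_cone_eq]
  exact Submodule.map_mono hle

theorem splitVec_ne_zero (hn : 3 ≤ n) {A : Set (Fin n)} (hnt : A.Nontrivial) (hA : h ∉ A)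
    (hAne : A ≠ {h}ᶜ) : splitVec A ≠ 0 := by
  intro h0
  refine mem_of_rayVec_mem_hull (w := fun _ => 1) (𝓕 := ∅)
    (isStar_one_iff.2 (nontrivial_compl_singleton hn h)) ⟨?_, ?_, ?_, ?_⟩ ?_
    (isStar_one_iff.2 hnt) hA hAne ?_
  · rintro _ ⟨⟩
  · rintro _ ⟨⟩
  · rintro _ ⟨⟩
  · rintro _ ⟨⟩
  · rintro _ ⟨⟩
  · rw [rayVec, ← prW_splitVec hA, h0, map_zero]
    exact Submodule.zero_mem _

theorem splitVec_injOn_clades (hn : 3 ≤ n) {T : CombType n} {A B : Set (Fin n)}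
    (hA : A ∈ T.clades h) (hB : B ∈ T.clades h) (hAB : splitVec A = splitVec B) : A = B := by
  have hT := T.isCladeFamily_clades h
  have hsub : ({B} : Set (Set (Fin n))) ⊆ T.clades h := Set.singleton_subset_iff.2 hB
  refine mem_of_rayVec_mem_hull (w := fun _ => 1) (𝓕 := {B})
    (isStar_one_iff.2 (nontrivial_compl_singleton hn h)) (hT.mono hsub)
    (fun I hI => isStar_one_iff.2 (hT.nontrivial I (hsub hI)))
    (isStar_one_iff.2 (hT.nontrivial A hA)) (hT.notMem A hA) (hT.ne_compl A hA) ?_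
  rw [rayVec, ← prW_splitVec (hT.notMem A hA), hAB, prW_splitVec (hT.notMem B hB)]
  exact Submodule.subset_span (Set.mem_image_of_mem _ rfl)

theorem CombType.ends_union_eq {T : CombType n} {p : T.V → T.V}
    (H : RootedBy T.graph (T.mark h) p) {v : T.V} (hv : v ≠ T.mark h) {a b : T.V ⊕ Fin n}
    (hab : T.branches h p v = {a, b}) : T.below p v = T.ends p a ∪ T.ends p b := by
  refine Set.Subset.antisymm (fun i hi => ?_) (Set.union_subset ?_ ?_)
  · have hih : i ≠ h := by
      rintro rfl
      exact hv ((mem_below_iff_eq_root H).1 hi)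
    obtain ⟨c, hc, hic⟩ := exists_mem_branches H hi hih
    rw [hab] at hc
    rcases hc with rfl | rfl
    · exact Or.inl hic
    · exact Or.inr hic
  · exact ends_subset (by rw [hab]; exact Or.inl rfl)
  · exact ends_subset (by rw [hab]; exact Or.inr rfl)

/-- If the projection is injective on the cone of a trivalent combinatorial type, then all clades
are connected: otherwise a smallest disconnected clade is obtained from a smaller clade or a single
element by adding an isolated vertex, which does not change the image of the ray. -/
theorem CombType.isStar_of_injOn (hn : 3 ≤ n) {T : CombType n} (hT : T.IsTop)
    (hinj : Set.InjOn (prW h w) T.cone) {A : Set (Fin n)} (hA : A ∈ T.clades h) : IsStar w A := by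
  obtain ⟨p, H⟩ := T.exists_rootedBy h
  have hfam := T.isCladeFamily_clades h
  have hcone : ∀ B ∈ T.clades h, splitVec B ∈ T.cone := by
    intro B hB
    rw [T.cone_eq h]
    exact Submodule.subset_span (Set.mem_image_of_mem _ hB)
  by_contra hcon
  obtain ⟨A, ⟨hA, hAs⟩, hmin⟩ := Set.exists_min_image {A | A ∈ T.clades h ∧ ¬ IsStar w A}
    Set.ncard (Set.toFinite _) ⟨A, hA, hcon⟩
  have hsmall : ∀ B ∈ T.clades h, B ⊂ A → IsStar w B := by
    intro B hB hBA
    by_contra h1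
    exact absurd (hmin B ⟨hB, h1⟩) (not_le.2 (Set.ncard_lt_ncard hBA))
  obtain ⟨v, hv, rfl⟩ := (mem_clades_iff H).1 hA
  obtain ⟨m, hm, hmax⟩ := Set.exists_max_image (T.below p v) w (Set.toFinite _)
    (below_nonempty H v)
  obtain ⟨x, hx, hxm, hmx⟩ : ∃ x ∈ T.below p v, x ≠ m ∧ w m + w x ≤ 1 := by
    by_contra h1
    push Not at h1
    exact hAs ⟨below_nontrivial H v, m, hm, h1⟩
  have hiso : ∀ y ∈ T.below p v, w x + w y ≤ 1 := fun y hy => by linarith [hmax y hy]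
  have hends : ∀ a ∈ T.branches h p v, x ∈ T.ends p a → T.ends p a = {x} := by
    rintro a ha hxa
    have hsub := ends_subset ha
    obtain ⟨b, hb, hba⟩ := exists_ne_branch H (v := v) a
    obtain ⟨y, hy⟩ := ends_nonempty H b
    rcases ha with ⟨c, ⟨hc, rfl⟩, rfl⟩ | ⟨i, ⟨hi, rfl⟩, rfl⟩
    · exfalso
      have hss : T.below p c ⊂ T.below p (p c) := by
        refine ⟨hsub, fun h1 => ?_⟩
        exact Set.disjoint_left.1 (disjoint_ends H hb (Or.inl ⟨c, ⟨hc, rfl⟩, rfl⟩) hba) hy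
          (h1 (ends_subset hb hy))
      obtain ⟨z, hz, -, hxz⟩ := (hsmall _ ((mem_clades_iff H).2 ⟨c, hc, rfl⟩) hss).exists_adj hxa
      exact absurd (hiso z (hsub hz)) (not_le.2 hxz)
    · have : x = i := hxa
      rw [this]
      rfl
  have hxh : x ≠ h := by rintro rfl; exact hfam.notMem _ hA hx
  obtain ⟨a, ha, hxa⟩ := exists_mem_branches H hx hxh
  obtain ⟨b, hb, hba⟩ := exists_ne_branch H (v := v) a
  have hab : T.branches h p v = {a, b} := by
    refine (Set.eq_of_subset_of_ncard_le (Set.pair_subset ha hb) ?_).symm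
    rw [(isTop_iff H).1 hT v, Set.ncard_pair hba.symm]
  have hunion := ends_union_eq H hv hab
  rw [hends a ha hxa] at hunion
  -- Adding the isolated vertex `x` does not add edges.
  have hedges : edgesIn w h (T.below p v) = edgesIn w h (T.ends p b) := by
    refine Set.Subset.antisymm (fun e he => ?_) (edgesIn_mono (ends_subset hb))
    induction e using Sym2.ind with
    | _ i j =>
      obtain ⟨hadj, hi, hj⟩ := mk_mem_edgesIn.1 he
      have hw := (reducedWeightGraph_adj.1 hadj).2
      have hix : i.1 ≠ x := fun h1 => absurd (hiso _ hj) (not_le.2 (h1 ▸ hw))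
      have hjx : j.1 ≠ x := fun h1 =>
        absurd (hiso _ hi) (not_le.2 (by rw [add_comm]; exact h1 ▸ hw))
      rw [hunion] at hi hj
      exact mk_mem_edgesIn.2 ⟨hadj, hi.resolve_left hix, hj.resolve_left hjx⟩
  have himage : prW h w (splitVec (T.below p v)) =
      flatVec (cycleMatroid (reducedWeightGraph w h)) (edgesIn w h (T.ends p b)) := by
    rw [prW_splitVec (hfam.notMem _ hA), hedges]
  have hdisj := disjoint_ends H hb ha hba
  rcases hb with ⟨c, ⟨hc, hcv⟩, rfl⟩ | ⟨i, ⟨-, -⟩, rfl⟩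
  · have hcA : T.below p c ∈ T.clades h := (mem_clades_iff H).2 ⟨c, hc, rfl⟩
    have h1 : splitVec (T.below p v) = splitVec (T.below p c) := by
      refine hinj (hcone _ hA) (hcone _ hcA) ?_
      rw [himage, prW_splitVec (hfam.notMem _ hcA)]
      rfl
    have h2 := splitVec_injOn_clades hn hA hcA h1
    rw [h2] at hx
    exact Set.disjoint_left.1 hdisj hx hxa
  · refine splitVec_ne_zero hn (hfam.nontrivial _ hA) (hfam.notMem _ hA) (hfam.ne_compl _ hA) ?_
    refine hinj (hcone _ hA) (Submodule.zero_mem _) ?_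
    have hempty : edgesIn w h (T.ends p (Sum.inr i)) = ∅ := by
      rw [Set.eq_empty_iff_forall_notMem]
      intro e he
      induction e using Sym2.ind with
      | _ j k =>
        obtain ⟨hadj, hj, hk⟩ := mk_mem_edgesIn.1 he
        have hj : j.1 = i := hj
        have hk : k.1 = i := hk
        exact hadj.ne (Subtype.ext (hj.trans hk.symm))
    rw [himage, hempty, flatVec_empty, map_zero]

theorem CombType.injOn_of_isStar (hN : IsStar w {h}ᶜ) {T : CombType n}
    (hstar : ∀ I ∈ T.clades h, IsStar w I) : Set.InjOn (prW h w) T.cone := by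
  have hfam := T.isCladeFamily_clades h
  intro x hx y hy hxy
  rw [T.cone_eq h] at hx hy
  obtain ⟨c, -, hc, rfl⟩ := (mem_hull_image_iff _ _ _).1 hx
  obtain ⟨d, -, hd, rfl⟩ := (mem_hull_image_iff _ _ _).1 hy
  rw [prW_sum fun I hI => hc I fun h1 => hfam.notMem I h1 hI,
    prW_sum fun I hI => hd I fun h1 => hfam.notMem I h1 hI] at hxy
  have key : ∀ I, c I - d I ∈ (⊥ : AddSubgroup ℝ) := by
    refine coeff_mem (c := fun I => c I - d I) hN hfam hstar ⊥ (fun I hI => ?_) (x := 0)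
      (fun _ => rfl) ?_
    · rw [hc I hI, hd I hI, sub_zero]
    · rw [map_zero]
      simp only [sub_smul]
      rw [Finset.sum_sub_distrib, hxy, sub_self]
  refine Finset.sum_congr rfl fun I _ => ?_
  rw [sub_eq_zero.1 (AddSubgroup.mem_bot.1 (key I))]

/-- A vertex of valence at least four allows the family of connected clades to be enlarged: the
branch that contains a vertex adjacent to all others is united with one other branch. -/
theorem CombType.exists_isCladeFamily_insert (hN : IsStar w {h}ᶜ) {T : CombType n}
    {p : T.V → T.V} (H : RootedBy T.graph (T.mark h) p) (hstar : ∀ I ∈ T.clades h, IsStar w I)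
    {v : T.V} (hv : 2 < (T.branches h p v).ncard) :
    ∃ I, I ∉ T.clades h ∧ IsStar w I ∧ IsCladeFamily h (insert I (T.clades h)) := by
  have hfam := T.isCladeFamily_clades h
  have hA : IsStar w (T.below p v \ {h}) := by
    by_cases hvr : v = T.mark h
    · rw [hvr, below_root H, ← Set.compl_eq_univ_sdiff]
      exact hN
    · have h1 := (mem_clades_iff H).2 ⟨v, hvr, rfl⟩
      rw [Set.sdiff_singleton_eq_self (hfam.notMem _ h1)]
      exact hstar _ h1
  obtain ⟨-, m, hm, hadj⟩ := hA
  obtain ⟨a, ha, hma⟩ := exists_mem_branches H hm.1 hm.2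
  obtain ⟨b, hb, hba⟩ := exists_ne_branch H (v := v) a
  obtain ⟨c, hc, hcab⟩ : ∃ c ∈ T.branches h p v, c ∉ ({a, b} : Set (T.V ⊕ Fin n)) := by
    refine Set.exists_mem_notMem_of_ncard_lt_ncard ?_ (Set.toFinite _)
    rwa [Set.ncard_pair hba.symm]
  have hca : c ≠ a := fun h1 => hcab (Or.inl h1)
  have hcb : c ≠ b := fun h1 => hcab (Or.inr h1)
  obtain ⟨y, hy⟩ := ends_nonempty H b
  obtain ⟨z, hz⟩ := ends_nonempty H c
  have hzab : z ∉ T.ends p a ∪ T.ends p b := by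
    rintro (h1 | h1)
    · exact Set.disjoint_left.1 (disjoint_ends H hc ha hca) hz h1
    · exact Set.disjoint_left.1 (disjoint_ends H hc hb hcb) hz h1
  have hsub : T.ends p a ∪ T.ends p b ⊆ T.below p v :=
    Set.union_subset (ends_subset ha) (ends_subset hb)
  have hhI : h ∉ T.ends p a ∪ T.ends p b := fun h1 =>
    h1.elim (notMem_ends H ha) (notMem_ends H hb)
  have hne : T.ends p a ∪ T.ends p b ≠ {h}ᶜ := by
    intro h1
    rw [h1] at hzab
    have : z = h := by simpa using hzab
    rw [this] at hz
    exact notMem_ends H hc hz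
  have hnt : (T.ends p a ∪ T.ends p b).Nontrivial := by
    refine ⟨m, Or.inl hma, y, Or.inr hy, ?_⟩
    rintro rfl
    exact Set.disjoint_left.1 (disjoint_ends H hb ha hba) hy hma
  -- A clade either contains the clade at `v`, or lies in a branch at `v`, or is disjoint from it.
  have htri : ∀ J ∈ T.clades h, T.below p v ⊆ J ∨ (∃ d ∈ T.branches h p v, J ⊆ T.ends p d) ∨
      Disjoint (T.below p v) J := by
    intro J hJ
    obtain ⟨u, -, rfl⟩ := (mem_clades_iff H).1 hJ
    by_cases hd : Disjoint (T.below p v) (T.below p u)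
    · exact Or.inr (Or.inr hd)
    · obtain ⟨i, hi, hi'⟩ := Set.not_disjoint_iff.1 hd
      by_cases huv : Anc p u v
      · exact Or.inl (below_mono huv)
      · have hvu : Anc p v u := (Anc.total hi hi').resolve_right huv
        obtain ⟨c', hc', hcv, hcu⟩ := H.exists_child hvu fun h1 => huv (h1 ▸ Anc.refl _ _)
        exact Or.inr (Or.inl ⟨Sum.inl c', Or.inl ⟨c', ⟨hc', hcv⟩, rfl⟩, below_mono hcu⟩)
  have hcomp : ∀ J ∈ T.clades h, T.ends p a ∪ T.ends p b ⊆ J ∨ J ⊆ T.ends p a ∪ T.ends p b ∨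
      Disjoint (T.ends p a ∪ T.ends p b) J := by
    intro J hJ
    rcases htri J hJ with h1 | ⟨d, hd, h1⟩ | h1
    · exact Or.inl (hsub.trans h1)
    · by_cases hda : d = a
      · exact Or.inr (Or.inl (h1.trans (hda ▸ Set.subset_union_left)))
      by_cases hdb : d = b
      · exact Or.inr (Or.inl (h1.trans (hdb ▸ Set.subset_union_right)))
      refine Or.inr (Or.inr (Disjoint.mono_right h1 (Set.disjoint_union_left.2 ⟨?_, ?_⟩)))
      · exact disjoint_ends H ha hd (Ne.symm hda)
      · exact disjoint_ends H hb hd (Ne.symm hdb)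
    · exact Or.inr (Or.inr (Disjoint.mono_left hsub h1))
  refine ⟨T.ends p a ∪ T.ends p b, fun hI => ?_, ⟨hnt, m, Or.inl hma, fun x hx => ?_⟩, ?_⟩
  · rcases htri _ hI with h1 | ⟨d, hd, h1⟩ | h1
    · exact hzab (h1 (ends_subset hc hz))
    · have h2 : d = a := by
        by_contra h3
        exact Set.disjoint_left.1 (disjoint_ends H ha hd (Ne.symm h3)) hma (h1 (Or.inl hma))
      have h3 : d = b := by
        by_contra h3
        exact Set.disjoint_left.1 (disjoint_ends H hb hd (Ne.symm h3)) hy (h1 (Or.inr hy))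
      exact hba (h3.symm.trans h2)
    · exact Set.disjoint_left.1 h1 (hsub (Or.inl hma)) (Or.inl hma)
  · exact hadj x ⟨hsub hx, by rintro rfl; exact hhI hx⟩
  · refine ⟨?_, ?_, ?_, ?_⟩
    · rintro I (rfl | hI) J (rfl | hJ)
      · exact Or.inl subset_rfl
      · exact hcomp J hJ
      · rcases hcomp I hI with h1 | h1 | h1
        · exact Or.inr (Or.inl h1)
        · exact Or.inl h1
        · exact Or.inr (Or.inr h1.symm)
      · exact hfam.laminar I hI J hJ
    · rintro I (rfl | hI)
      · exact hhI
      · exact hfam.notMem I hI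
    · rintro I (rfl | hI)
      · exact hnt
      · exact hfam.nontrivial I hI
    · rintro I (rfl | hI)
      · exact hne
      · exact hfam.ne_compl I hI

theorem survives_iff (hn : 3 ≤ n) (hN : IsStar w {h}ᶜ) {T : CombType n} :
    Survives h w T ↔ ∀ I ∈ T.clades h, IsStar w I := by
  constructor
  · rintro ⟨T', htop, hinj, hle⟩ I hI
    exact T'.isStar_of_injOn hn htop hinj (CombType.clades_subset_of_cone_le hn h hle hI)
  · intro hstar
    obtain ⟨𝓕, hle, hmax⟩ := (Set.toFinite {𝓕 : Set (Set (Fin n)) | IsCladeFamily h 𝓕 ∧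
      ∀ I ∈ 𝓕, IsStar w I}).exists_le_maximal ⟨T.isCladeFamily_clades h, hstar⟩
    obtain ⟨h𝓕, hstar'⟩ := hmax.prop
    obtain ⟨T', rfl⟩ := CombType.exists_clades_eq hn h𝓕
    obtain ⟨p, H⟩ := T'.exists_rootedBy h
    refine ⟨T', (CombType.isTop_iff H).2 fun v => ?_, CombType.injOn_of_isStar hN hstar', ?_⟩
    · by_contra hv
      have hv : 2 < (T'.branches h p v).ncard :=
        lt_of_le_of_ne (CombType.two_le_branches H v) (Ne.symm hv)
      obtain ⟨I, hI, hIs, hfam⟩ := CombType.exists_isCladeFamily_insert hN H hstar' hv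
      refine hI (hmax.le_of_ge ⟨hfam, ?_⟩ (Set.subset_insert _ _) (Set.mem_insert _ _))
      rintro J (rfl | hJ)
      · exact hIs
      · exact hstar' J hJ
    · rw [T.cone_eq h, T'.cone_eq h]
      exact Submodule.span_mono (Set.image_mono hle)

end Survives

/-! ### The support of the subdivision -/

section Support

variable {n : ℕ} {w : Fin n → ℚ} {h : Fin n}

/-- The function `-∑ c_I` over the members of a laminar family that contain both ends of an edge
satisfies the ultrametric inequality, so no edge is spanned by lighter ones. -/
theorem sum_rayVec_mem_reducedBergmanFan {𝓕 : Set (Set (Fin n))} (h𝓕 : IsLaminar 𝓕)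
    {c : Set (Fin n) → ℝ} (hc : ∀ I, 0 ≤ c I) (hc0 : ∀ I, I ∉ 𝓕 → c I = 0) :
    ∑ I, c I • rayVec w h I ∈ reducedBergmanFan (cycleMatroid (reducedWeightGraph w h)) := by
  classical
  rw [sum_smul_rayVec]
  refine Set.mem_image_of_mem _ ((mem_bergmanFan_cycleMatroid_iff _).2 fun u v huv hr => ?_)
  let y : Fin n → Fin n → ℝ := fun a b => -∑ I, if a ∈ I ∧ b ∈ I then c I else 0
  have hxy : ∀ i j (hij : (reducedWeightGraph w h).Adj i j),
      (-∑ I, if ((⟨s(i, j), hij⟩ : (cycleMatroid (reducedWeightGraph w h)).E) :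
        Sym2 (Others h)) ∈ edgesIn w h I then c I else 0) = y i.1 j.1 := by
    intro i j hij
    refine congrArg _ (Finset.sum_congr rfl fun I _ => if_congr ?_ rfl rfl)
    exact mk_mem_edgesIn.trans (and_iff_right hij)
  have hmono : ∀ a b a' b', (∀ I ∈ 𝓕, a ∈ I ∧ b ∈ I → a' ∈ I ∧ b' ∈ I) → y a' b' ≤ y a b := by
    intro a b a' b' hsub
    refine neg_le_neg (Finset.sum_le_sum fun I _ => ?_)
    by_cases hI : I ∈ 𝓕
    · by_cases hab : a ∈ I ∧ b ∈ I
      · rw [if_pos hab, if_pos (hsub I hI hab)]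
      · rw [if_neg hab]
        split_ifs
        · exact hc I
        · exact le_rfl
    · rw [hc0 I hI, ite_self, ite_self]
  have hultra : ∀ a b d t, y a b < t → y b d < t → y a d < t := by
    intro a b d t hab hbd
    by_cases hsub : ∀ I ∈ 𝓕, a ∈ I ∧ b ∈ I → d ∈ I
    · exact (hmono a b a d fun I hI h1 => ⟨h1.1, hsub I hI h1⟩).trans_lt hab
    · push Not at hsub
      obtain ⟨I, hI, ⟨ha, hb⟩, hd⟩ := hsub
      refine (hmono b d a d fun J hJ h1 => ⟨?_, h1.2⟩).trans_lt hbd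
      rcases h𝓕 I hI J hJ with h2 | h2 | h2
      · exact h2 ha
      · exact absurd (h2 h1.2) hd
      · exact absurd h1.1 (Set.disjoint_left.1 h2 hb)
  rw [hxy u v huv] at hr
  have key : ∀ i j : Others h, (SimpleGraph.fromEdgeSet (Subtype.val ''
      {f : (cycleMatroid (reducedWeightGraph w h)).E | (-∑ I, if (f : Sym2 (Others h)) ∈
        edgesIn w h I then c I else 0) < y u.1 v.1})).Reachable i j →
      i = j ∨ y i.1 j.1 < y u.1 v.1 := by
    rintro i j ⟨q⟩
    induction q with
    | nil => exact Or.inl rfl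
    | @cons a b d hab _ ih =>
      rw [SimpleGraph.fromEdgeSet_adj] at hab
      obtain ⟨⟨⟨e, he⟩, hlt, rfl⟩, -⟩ := hab
      have hlt : (-∑ I, if s(a, b) ∈ edgesIn w h I then c I else 0) < y u.1 v.1 := hlt
      have h1 := hxy a b he
      simp only at h1
      rw [h1] at hlt
      rcases ih with rfl | h2
      · exact Or.inr hlt
      · exact Or.inr (hultra _ _ _ _ hlt h2)
  rcases key u v hr with h1 | h1
  · exact huv.ne h1
  · exact lt_irrefl _ h1

/-- The vertex set of the connected component of `i` in the graph formed by the edges at which `x`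
is less than `t`. -/
def levelComponent (x : (cycleMatroid (reducedWeightGraph w h)).E → ℝ) (t : ℝ) (i : Others h) :
    Set (Fin n) :=
  Subtype.val '' {j | (SimpleGraph.fromEdgeSet (Subtype.val '' {f | x f < t})).Reachable i j}

/-- The components of the sublevel graphs of `x` that are neither single vertices nor everything. -/
def levelFamily (x : (cycleMatroid (reducedWeightGraph w h)).E → ℝ) : Set (Set (Fin n)) :=
  {I | (∃ t i, I = levelComponent x t i) ∧ I.Nontrivial ∧ I ≠ {h}ᶜ}

theorem mem_levelComponent {x : (cycleMatroid (reducedWeightGraph w h)).E → ℝ} {t : ℝ}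
    {i j : Others h} : j.1 ∈ levelComponent x t i ↔
      (SimpleGraph.fromEdgeSet (Subtype.val '' {f | x f < t})).Reachable i j := by
  constructor
  · rintro ⟨k, hk, hkj⟩
    obtain rfl := Subtype.ext hkj
    exact hk
  · exact fun hj => ⟨j, hj, rfl⟩

theorem levelComponent_eq_of_mem {x : (cycleMatroid (reducedWeightGraph w h)).E → ℝ} {t : ℝ}
    {i j : Others h} (hj : j.1 ∈ levelComponent x t i) :
    levelComponent x t i = levelComponent x t j := by
  have hij := mem_levelComponent.1 hj
  exact congrArg (Set.image Subtype.val) (Set.ext fun k =>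
    ⟨fun hk => hij.symm.trans hk, fun hk => hij.trans hk⟩)

theorem levelComponent_mono (x : (cycleMatroid (reducedWeightGraph w h)).E → ℝ) {s t : ℝ}
    (hst : s ≤ t) (i : Others h) : levelComponent x s i ⊆ levelComponent x t i := by
  refine Set.image_mono fun j hj => SimpleGraph.Reachable.mono (SimpleGraph.fromEdgeSet_mono ?_) hj
  exact Set.image_mono fun f hf => lt_of_lt_of_le hf hst

theorem notMem_levelComponent (x : (cycleMatroid (reducedWeightGraph w h)).E → ℝ) (t : ℝ)
    (i : Others h) : h ∉ levelComponent x t i := by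
  rintro ⟨j, -, hj⟩
  exact j.2 hj

theorem isCladeFamily_levelFamily (x : (cycleMatroid (reducedWeightGraph w h)).E → ℝ) :
    IsCladeFamily h (levelFamily x) := by
  refine ⟨?_, ?_, fun I hI => hI.2.1, fun I hI => hI.2.2⟩
  · rintro _ ⟨⟨s, i, rfl⟩, -⟩ _ ⟨⟨t, j, rfl⟩, -⟩
    by_cases hd : Disjoint (levelComponent x s i) (levelComponent x t j)
    · exact Or.inr (Or.inr hd)
    · obtain ⟨k, hk, hk'⟩ := Set.not_disjoint_iff.1 hd
      have hkh : k ≠ h := by rintro rfl; exact notMem_levelComponent x s i hk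
      rw [levelComponent_eq_of_mem (j := ⟨k, hkh⟩) hk, levelComponent_eq_of_mem (j := ⟨k, hkh⟩) hk']
      rcases le_total s t with hst | hst
      · exact Or.inl (levelComponent_mono x hst _)
      · exact Or.inr (Or.inl (levelComponent_mono x hst _))
  · rintro _ ⟨⟨t, i, rfl⟩, -⟩
    exact notMem_levelComponent x t i

/-- For a point `x` of the Bergman fan the sublevel sets are flats, hence the disjoint unions of the
edge sets of their components. -/
theorem mkQ_sublevel_mem_hull {x : (cycleMatroid (reducedWeightGraph w h)).E → ℝ}
    (hx : x ∈ bergmanFan (cycleMatroid (reducedWeightGraph w h))) (t : ℝ) :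
    (lineality _).mkQ (fun e => if x e < t then -1 else 0) ∈
      PointedCone.hull ℝ (rayVec w h '' levelFamily x) := by
  classical
  rw [mem_bergmanFan_cycleMatroid_iff] at hx
  let c : Set (Fin n) → ℝ := fun I =>
    if (∃ i, I = levelComponent x t i) ∧ I.Nontrivial then 1 else 0
  have hsum : (lineality (cycleMatroid (reducedWeightGraph w h))).mkQ
      (fun e => if x e < t then -1 else 0) = ∑ I, c I • rayVec w h I := by
    rw [sum_smul_rayVec]
    congr 1
    ext ⟨e, he⟩
    induction e using Sym2.ind with
    | _ i j =>
      have hadj : (reducedWeightGraph w h).Adj i j := he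
      by_cases hlt : x ⟨s(i, j), he⟩ < t
      · rw [if_pos hlt, Finset.sum_eq_single (levelComponent x t i)]
        · have hi : i.1 ∈ levelComponent x t i :=
            mem_levelComponent.2 (SimpleGraph.Reachable.refl _)
          have hj : j.1 ∈ levelComponent x t i := by
            refine mem_levelComponent.2 (SimpleGraph.Adj.reachable ?_)
            rw [SimpleGraph.fromEdgeSet_adj]
            exact ⟨⟨⟨s(i, j), he⟩, hlt, rfl⟩, hadj.ne⟩
          have hnt : (levelComponent x t i).Nontrivial :=
            ⟨i.1, hi, j.1, hj, fun h1 => hadj.ne (Subtype.ext h1)⟩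
          rw [if_pos (mk_mem_edgesIn.2 ⟨hadj, hi, hj⟩)]
          simp only [c]
          rw [if_pos ⟨⟨i, rfl⟩, hnt⟩]
        · intro I _ hI
          split_ifs with h1
          · refine if_neg fun h2 => hI ?_
            obtain ⟨⟨k, rfl⟩, -⟩ := h2
            exact levelComponent_eq_of_mem (mk_mem_edgesIn.1 h1).2.1
          · rfl
        · exact fun h1 => absurd (Finset.mem_univ _) h1
      · rw [if_neg hlt, Finset.sum_eq_zero, neg_zero]
        intro I _
        split_ifs with h1
        · refine if_neg fun h2 => hx i j hadj ?_
          obtain ⟨⟨k, rfl⟩, -⟩ := h2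
          obtain ⟨-, hi, hj⟩ := mk_mem_edgesIn.1 h1
          refine ((mem_levelComponent.1 hi).symm.trans (mem_levelComponent.1 hj)).mono
            (SimpleGraph.fromEdgeSet_mono (Set.image_mono fun f hf => ?_))
          exact lt_of_lt_of_le hf (not_lt.1 hlt)
        · rfl
  rw [hsum]
  refine Submodule.sum_mem _ fun I _ => ?_
  by_cases hI : (∃ i, I = levelComponent x t i) ∧ I.Nontrivial
  · simp only [c]
    rw [if_pos hI, one_smul]
    by_cases hne : I = {h}ᶜ
    · rw [hne, rayVec, flatVec_edgesIn_compl]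
      exact Submodule.zero_mem _
    · exact Submodule.subset_span (Set.mem_image_of_mem _
        ⟨⟨t, hI.1⟩, hI.2, hne⟩)
  · simp only [c]
    rw [if_neg hI, zero_smul]
    exact Submodule.zero_mem _

/-- Every point of the Bergman fan is, up to a constant, a nonnegative combination of the indicator
vectors of its sublevel sets; the induction truncates `x` at its successive values. -/
theorem mkQ_mem_hull_levelFamily {x : (cycleMatroid (reducedWeightGraph w h)).E → ℝ}
    (hx : x ∈ bergmanFan (cycleMatroid (reducedWeightGraph w h))) :
    (lineality _).mkQ x ∈ PointedCone.hull ℝ (rayVec w h '' levelFamily x) := by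
  classical
  have hfin : (Set.range x).Finite := Set.toFinite _
  have key : ∀ (k : ℕ) (s : ℝ), ({t | t ∈ Set.range x ∧ t < s}).ncard = k →
      (lineality _).mkQ (fun e => min (x e) s) ∈
        PointedCone.hull ℝ (rayVec w h '' levelFamily x) := by
    intro k
    induction k using Nat.strong_induction_on with
    | _ k ih =>
      intro s hk
      by_cases hne : ({t | t ∈ Set.range x ∧ t < s}).Nonempty
      · obtain ⟨s', ⟨hs', hs's⟩, hmax⟩ := Set.exists_max_image _ id
          (hfin.subset fun t ht => ht.1) hne
        have h1 := ih _ (by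
          rw [← hk]
          refine Set.ncard_lt_ncard ⟨fun t ht => ⟨ht.1, ht.2.trans hs's⟩, fun hsub => ?_⟩
            (hfin.subset fun t ht => ht.1)
          exact lt_irrefl _ (hsub ⟨hs', hs's⟩ : s' ∈ Set.range x ∧ s' < s').2) s' rfl
        have h2 : (lineality (cycleMatroid (reducedWeightGraph w h))).mkQ
            (fun e => min (x e) s) = (lineality _).mkQ (fun e => min (x e) s') +
              (s - s') • (lineality _).mkQ (fun e => if x e < s then -1 else 0) := by
          rw [← map_smul, ← map_add, mkQ_lineality_eq_iff]
          refine ⟨s - s', fun e => ?_⟩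
          simp only [Pi.add_apply, Pi.smul_apply, smul_eq_mul]
          by_cases he : x e < s
          · have h3 : x e ≤ s' := hmax _ ⟨⟨e, rfl⟩, he⟩
            rw [if_pos he, min_eq_left he.le, min_eq_left h3]
            ring
          · rw [if_neg he, min_eq_right (not_lt.1 he),
              min_eq_right (hs's.le.trans (not_lt.1 he))]
            ring
        rw [h2]
        exact Submodule.add_mem _ h1 (Submodule.smul_mem _
          (⟨s - s', sub_nonneg.2 hs's.le⟩ : {c : ℝ // 0 ≤ c}) (mkQ_sublevel_mem_hull hx s))
      · have h1 : (lineality (cycleMatroid (reducedWeightGraph w h))).mkQ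
            (fun e => min (x e) s) = (lineality _).mkQ 0 := by
          rw [mkQ_lineality_eq_iff]
          refine ⟨s, fun e => ?_⟩
          have h2 : ¬ x e < s := fun h3 => hne ⟨x e, ⟨e, rfl⟩, h3⟩
          rw [min_eq_right (not_lt.1 h2), Pi.zero_apply, zero_add]
        rw [h1, map_zero]
        exact Submodule.zero_mem _
  obtain ⟨s, hs⟩ := hfin.bddAbove
  have h1 := key _ s rfl
  have h2 : (fun e => min (x e) s) = x := funext fun e => min_eq_left (hs ⟨e, rfl⟩)
  rwa [h2] at h1

theorem prW_image_tropicalModuli (hn : 3 ≤ n) :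
    prW h w '' tropicalModuli n =
      reducedBergmanFan (cycleMatroid (reducedWeightGraph w h)) := by
  apply Set.Subset.antisymm
  · rintro _ ⟨_, ⟨C, rfl⟩, rfl⟩
    have hfam := C.toCombType.isCladeFamily_clades h
    obtain ⟨c, hc, hc0, hC⟩ := C.exists_distVec_eq h
    rw [hC, prW_sum fun I hI => hc0 I fun h1 => hfam.notMem I h1 hI]
    exact sum_rayVec_mem_reducedBergmanFan hfam.laminar hc hc0
  · rintro _ ⟨x, hx, rfl⟩
    obtain ⟨c, hc, hc0, hsum⟩ := (mem_hull_image_iff _ _ _).1 (mkQ_mem_hull_levelFamily hx)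
    have hfam := isCladeFamily_levelFamily x
    have hsub : {I | c I ≠ 0} ⊆ levelFamily x := fun I hI => by
      by_contra h1
      exact hI (hc0 I h1)
    obtain ⟨C, hC⟩ := exists_tropicalCurve hn (hfam.mono hsub) c
      (fun I hI => lt_of_le_of_ne (hc I) (Ne.symm hI)) (fun I hI => not_not.1 hI)
    refine ⟨C.distVec, ⟨C, rfl⟩, ?_⟩
    rw [hC, hsum, prW_sum fun I hI => hc0 I fun h1 => hfam.notMem I h1 hI]

end Support

/-! ### Cones and lattices -/

section Cones

variable {n : ℕ} {w : Fin n → ℚ} {h : Fin n}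

/-- A clade without edges maps to zero, and any other to the ray of a 1-connected flat. -/
theorem map_cone_mem_nestedSubdivision (T : CombType n) :
    T.cone.map (prW h w) ∈ nestedSubdivision (cycleMatroid (reducedWeightGraph w h))
      (oneConnectedFlats (reducedWeightGraph w h)) := by
  have hfam := T.isCladeFamily_clades h
  refine ⟨_, isNested_edgesIn (w := w) (h := h) hfam.laminar, ?_⟩
  rw [T.map_cone_eq, nestedCone]
  apply le_antisymm
  · refine Submodule.span_le.2 ?_
    rintro _ ⟨I, hI, rfl⟩
    rcases Set.eq_empty_or_nonempty (edgesIn w h I) with h1 | h1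
    · rw [rayVec, h1, flatVec_empty]
      exact Submodule.zero_mem _
    · obtain ⟨J, hhJ, hJ, hIJ⟩ := exists_isStar_edgesIn_eq (hfam.notMem I hI) h1
      refine Submodule.subset_span (Set.mem_image_of_mem _ ⟨⟨I, hI, rfl⟩, ?_⟩)
      exact mem_oneConnectedFlats_iff.2 ⟨J, hhJ, hJ, hIJ.symm⟩
  · refine Submodule.span_mono ?_
    rintro _ ⟨_, ⟨⟨I, hI, rfl⟩, -⟩, rfl⟩
    exact ⟨I, hI, rfl⟩

theorem exists_survives_map_cone_eq (hn : 3 ≤ n) (hN : IsStar w {h}ᶜ)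
    {τ : PointedCone ℝ (BergmanSpace (cycleMatroid (reducedWeightGraph w h)))}
    (hτ : τ ∈ nestedSubdivision (cycleMatroid (reducedWeightGraph w h))
      (oneConnectedFlats (reducedWeightGraph w h))) :
    ∃ T : CombType n, Survives h w T ∧ T.cone.map (prW h w) = τ := by
  obtain ⟨S, hS, rfl⟩ := hτ
  have hlam := isLaminar_of_isNested hS
  obtain ⟨T, hT⟩ := CombType.exists_clades_eq (h := h) hn
    (𝓕 := {I | (h ∉ I ∧ IsStar w I ∧ edgesIn w h I ∈ S) ∧ I ≠ {h}ᶜ})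
    ⟨fun I hI J hJ => hlam I hI.1 J hJ.1, fun I hI => hI.1.1, fun I hI => hI.1.2.1.1,
      fun I hI => hI.2⟩
  refine ⟨T, (survives_iff hn hN).2 fun I hI => ?_, ?_⟩
  · rw [hT] at hI
    exact hI.1.2.1
  · rw [T.map_cone_eq, hT, nestedCone]
    apply le_antisymm
    · refine Submodule.span_mono ?_
      rintro _ ⟨I, hI, rfl⟩
      exact ⟨_, hI.1.2.2, rfl⟩
    · refine Submodule.span_le.2 ?_
      rintro _ ⟨F, hF, rfl⟩
      obtain ⟨I, hhI, hI, rfl⟩ := mem_oneConnectedFlats_iff.1 (hS.1 hF)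
      by_cases hne : I = {h}ᶜ
      · rw [hne, flatVec_edgesIn_compl]
        exact Submodule.zero_mem _
      · exact Submodule.subset_span ⟨I, ⟨⟨hhI, hI, hF⟩, hne⟩, rfl⟩

theorem map_cone_le_iff (hn : 3 ≤ n) (hN : IsStar w {h}ᶜ) {T T' : CombType n}
    (hT : Survives h w T) (hT' : Survives h w T') :
    T.cone.map (prW h w) ≤ T'.cone.map (prW h w) ↔ T.clades h ⊆ T'.clades h := by
  rw [T.map_cone_eq, T'.map_cone_eq]
  exact hull_rayVec_le_iff hN (T.isCladeFamily_clades h) ((survives_iff hn hN).1 hT)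
    (T'.isCladeFamily_clades h) ((survives_iff hn hN).1 hT')

theorem cone_le_iff (hn : 3 ≤ n) (h : Fin n) {T T' : CombType n} :
    T.cone ≤ T'.cone ↔ T.clades h ⊆ T'.clades h := by
  refine ⟨CombType.clades_subset_of_cone_le hn h, fun hsub => ?_⟩
  rw [T.cone_eq h, T'.cone_eq h]
  exact Submodule.span_mono (Set.image_mono hsub)

theorem flatVec_mem_bergmanLattice {α : Type*} (M : Matroid α) (F : Set α) :
    flatVec M F ∈ bergmanLattice M := by
  classical
  refine Set.mem_image_of_mem _ fun e => ?_
  by_cases he : (e : α) ∈ F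
  · exact ⟨-1, by simp [he]⟩
  · exact ⟨0, by simp [he]⟩

theorem prW_mem_bergmanLattice {z : CurveSpace n} (hz : z ∈ curveLattice n) :
    prW h w z ∈ bergmanLattice (cycleMatroid (reducedWeightGraph w h)) := by
  induction hz using AddSubgroup.closure_induction with
  | mem z hz =>
    obtain ⟨I, rfl⟩ := hz
    by_cases hI : h ∈ I
    · have hI' : h ∉ Iᶜ := fun h1 => h1 hI
      rw [← splitVec_compl, prW_splitVec hI']
      exact flatVec_mem_bergmanLattice _ _
    · rw [prW_splitVec hI]
      exact flatVec_mem_bergmanLattice _ _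
  | zero =>
    rw [map_zero]
    exact ⟨0, fun e => ⟨0, by simp⟩, map_zero _⟩
  | add y z _ _ hy hz =>
    obtain ⟨a, ha, hay⟩ := hy
    obtain ⟨b, hb, hbz⟩ := hz
    refine ⟨a + b, fun e => ?_, by rw [map_add, map_add, hay, hbz]⟩
    obtain ⟨k, hk⟩ := ha e
    obtain ⟨l, hl⟩ := hb e
    exact ⟨k + l, by simp [hk, hl]⟩
  | neg y _ hy =>
    obtain ⟨a, ha, hay⟩ := hy
    refine ⟨-a, fun e => ?_, by rw [map_neg, map_neg, hay]⟩
    obtain ⟨k, hk⟩ := ha e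
    exact ⟨-k, by simp [hk]⟩

theorem prW_image_lattice (hn : 3 ≤ n) (hN : IsStar w {h}ᶜ) {T : CombType n}
    (hT : Survives h w T) :
    prW h w '' ((curveLattice n : Set (CurveSpace n)) ∩
        Submodule.span ℝ (T.cone : Set (CurveSpace n)))
      = bergmanLattice (cycleMatroid (reducedWeightGraph w h)) ∩
        Submodule.span ℝ (T.cone.map (prW h w) :
          Set (BergmanSpace (cycleMatroid (reducedWeightGraph w h)))) := by
  have hfam := T.isCladeFamily_clades h
  apply Set.Subset.antisymm
  · rintro _ ⟨z, ⟨hz, hzT⟩, rfl⟩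
    refine ⟨prW_mem_bergmanLattice hz, ?_⟩
    have h1 := Submodule.mem_map_of_mem (f := prW h w) hzT
    rw [Submodule.map_span] at h1
    refine Submodule.span_mono ?_ h1
    rintro _ ⟨y, hy, rfl⟩
    exact PointedCone.mem_map.2 ⟨y, hy, rfl⟩
  · rintro y ⟨⟨x, hx, rfl⟩, hy⟩
    have h1 : (lineality (cycleMatroid (reducedWeightGraph w h))).mkQ x ∈
        Submodule.span ℝ (rayVec w h '' T.clades h) := by
      refine Submodule.span_le.2 ?_ hy
      rw [T.map_cone_eq (h := h)]
      exact PointedCone.hull_le_span _ _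
    obtain ⟨c, hc, hsum⟩ := exists_sum_of_mem_span_image _ _ h1
    have hint : ∀ I, c I ∈ (Int.castAddHom ℝ).range := by
      refine coeff_mem hN hfam ((survives_iff hn hN).1 hT) _ hc (x := x) (fun e => ?_) hsum.symm
      obtain ⟨k, hk⟩ := hx e
      exact ⟨k, hk.symm⟩
    refine ⟨∑ I, c I • splitVec I, ⟨?_, ?_⟩, ?_⟩
    · refine AddSubgroup.sum_mem _ fun I _ => ?_
      obtain ⟨k, hk⟩ := hint I
      rw [← hk, Int.coe_castAddHom, Int.cast_smul_eq_zsmul]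
      exact AddSubgroup.zsmul_mem _ (AddSubgroup.subset_closure (Set.mem_range_self I)) k
    · refine Submodule.sum_mem _ fun I _ => ?_
      by_cases hI : I ∈ T.clades h
      · refine Submodule.smul_mem _ _ (Submodule.subset_span ?_)
        rw [T.cone_eq h]
        exact Submodule.subset_span (Set.mem_image_of_mem _ hI)
      · rw [hc I hI, zero_smul]
        exact Submodule.zero_mem _
    · rw [hsum, prW_sum fun I hI => hc I fun h2 => hfam.notMem I h2 hI]

end Cones

end

theorem mainTheorem2 (n : ℕ) (hn : 3 ≤ n) (w : Fin n → ℚ) (hw : ∀ i, 0 < w i ∧ w i ≤ 1)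
    (h : Fin n) (hh : IsHeavy w h) (hh' : ∃ k, k ≠ h ∧ IsHeavy w k) :
    prW h w '' tropicalModuli n
        = reducedBergmanFan (cycleMatroid (reducedWeightGraph w h)) ∧
      (∀ T : CombType n, T.cone.map (prW h w) ∈
        nestedSubdivision (cycleMatroid (reducedWeightGraph w h))
          (oneConnectedFlats (reducedWeightGraph w h))) ∧
      (∀ τ ∈ nestedSubdivision (cycleMatroid (reducedWeightGraph w h))
          (oneConnectedFlats (reducedWeightGraph w h)),
        ∃ T : CombType n, (Survives h w T ∧ T.cone.map (prW h w) = τ) ∧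
          ∀ T' : CombType n, Survives h w T' → T'.cone.map (prW h w) = τ → T'.Iso T) ∧
      (∀ T T' : CombType n, Survives h w T → Survives h w T' →
        (T.cone ≤ T'.cone ↔ T.cone.map (prW h w) ≤ T'.cone.map (prW h w))) ∧
      (∀ T : CombType n, Survives h w T →
        prW h w '' ((curveLattice n : Set (CurveSpace n)) ∩
            Submodule.span ℝ (T.cone : Set (CurveSpace n)))
          = bergmanLattice (cycleMatroid (reducedWeightGraph w h)) ∩
            Submodule.span ℝ (T.cone.map (prW h w) :
              Set (BergmanSpace (cycleMatroid (reducedWeightGraph w h))))) := by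
  -- The second heavy entry is adjacent to all other vertices of the reduced weight graph.
  have hN : IsStar w {h}ᶜ := by
    obtain ⟨k, hkh, hk⟩ := hh'
    exact ⟨nontrivial_compl_singleton hn h, k, hkh, fun x _ hxk => hk x hxk⟩
  refine ⟨prW_image_tropicalModuli hn, map_cone_mem_nestedSubdivision, fun τ hτ => ?_,
    fun T T' hT hT' => ?_, fun T hT => prW_image_lattice hn hN hT⟩
  · obtain ⟨T, hT, hTτ⟩ := exists_survives_map_cone_eq hn hN hτ
    refine ⟨T, ⟨hT, hTτ⟩, fun T' hT' hT'τ => CombType.iso_of_clades_eq h ?_⟩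
    have heq := hT'τ.trans hTτ.symm
    exact Set.Subset.antisymm ((map_cone_le_iff hn hN hT' hT).1 heq.le)
      ((map_cone_le_iff hn hN hT hT').1 heq.ge)
  · rw [cone_le_iff hn h, map_cone_le_iff hn hN hT hT']
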